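/- All manifolds are smooth, Hausdorff and connected, and $n\ge 0$. A *Platonic wave* is a Lorentzian manifold $(M,g)$ of dimension $n+1$ (signature $(-,+,\dots,+)$) with a smooth nowhere vanishing vector field $\xi$ which is null, $g(\xi,\xi)=0$, and Killing, $\mathcal L_\xi g=0$, and for which there are a smooth function $\Omega>0$ (a *conformal factor*) and a Lorentzian metric $\bar g$ with $g=\Omega\,\bar g$ such that $\xi$ is parallel for the Levi-Civita connection of $\bar g$. Its *rays* are the orbits of $\xi$, and its *Platonic screen* $S$ is the orbit space of the rays, with projection $q:M\to S$. A *screen worldvolume* is an embedded $n$-dimensional submanifold $\sigma:W\to M$, transverse to $\xi$, which meets every ray exactly once. An *Aristotelian structure* on an $n$-dimensional manifold is a pair $(\psi,\gamma)$, where $\psi$ (the absolute clock) is a smooth nowhere vanishing 1-form with $\psi\wedge d\psi=0$ and $\gamma$ is a smooth positive definite metric on $\ker\psi$, hence a Riemannian metric on the absolute spaces (the integral hypersurfaces of $\ker\psi$). **Proposition.** Let $(M,g,\xi)$ be a Platonic wave whose Platonic screen $S$ is a quotient manifold of $M$, i.e. $S$, with the quotient topology, carries the structure of an $n$-dimensional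 manifold for which $q$ is a smooth submersion. Then: 1. There is a unique Aristotelian structure $(\psi,\gamma)$ on $S$ induced from the ambient metric, i.e. such that $q^*\psi=g(\xi,\cdot)$ and $\gamma(dq\,v,dq\,w)=g(v,w)$ for all $x\in M$ and all $v,w\in T_xM$ with $dq\,v,\,dq\,w\in\ker\psi$. 2. Every conformal factor $\Omega$ of the Platonic wave is the pullback by $q$ of a smooth positive function on $S$, again denoted by $\Omega$, and every point of $S$ has an open neighbourhood with a smooth function $t$ on it (an absolute time) such that $\psi=\Omega\,dt$ there. 3. The structure does not depend on the choice of screen worldvolume: for every screen worldvolume $\sigma:W\to M$, the restrictions to $W$ of $g(\xi,\cdot)$ and of $g$ (the latter to the kernel of the former) form an Aristotelian structure on $W$, and $q\circ\sigma:W\to S$ is a diffeomorphism under which it is the pullback of $(\psi,\gamma)$. -/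

import Mathlib

open scoped Manifold ContDiff

/-! All manifolds are smooth, without boundary, and modelled on some `EuclideanSpace ℝ (Fin m)`. -/

section Ambient

/-! ### Vector fields, one-forms, Lorentzian metrics -/

variable {m : ℕ} {M : Type*} [TopologicalSpace M] [ChartedSpace (EuclideanSpace ℝ (Fin m)) M]
  [IsManifold (𝓡 m) ∞ M]

/-- The vector field `X` is differentiable at the point `x`. -/
def VFieldDiffAt (X : (x : M) → TangentSpace (𝓡 m) x) (x : M) : Prop :=
  MDifferentiableAt (𝓡 m) (𝓡 m).tangent (fun y => (⟨y, X y⟩ : TangentBundle (𝓡 m) M)) x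

/-- The vector field `X` is smooth on the set `U`. -/
def VFieldSmoothOn (X : (x : M) → TangentSpace (𝓡 m) x) (U : Set M) : Prop :=
  ContMDiffOn (𝓡 m) (𝓡 m).tangent ∞ (fun y => (⟨y, X y⟩ : TangentBundle (𝓡 m) M)) U

/-- The one-form `ψ` is smooth. -/
def OneFormSmooth (ψ : (x : M) → TangentSpace (𝓡 m) x →L[ℝ] ℝ) : Prop :=
  ContMDiff (𝓡 m) ((𝓡 m).prod 𝓘(ℝ, EuclideanSpace ℝ (Fin m) →L[ℝ] ℝ)) ∞
    (fun x => Bundle.TotalSpace.mk' (EuclideanSpace ℝ (Fin m) →L[ℝ] ℝ)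
      (E := fun x : M => TangentSpace (𝓡 m) x →L[ℝ] ℝ) x (ψ x))

/-- The value at `x` of `dψ(X, Y) = X(ψ(Y)) - Y(ψ(X)) - ψ([X, Y])`, the exterior derivative of the
one-form `ψ` evaluated on two vector fields. -/
noncomputable def oneFormExtDeriv (ψ : (x : M) → TangentSpace (𝓡 m) x →L[ℝ] ℝ)
    (X Y : (x : M) → TangentSpace (𝓡 m) x) (x : M) : ℝ :=
  mvfderiv (𝓡 m) (fun y => ψ y (Y y)) x (X x) - mvfderiv (𝓡 m) (fun y => ψ y (X y)) x (Y x)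
    - ψ x (VectorField.mlieBracket (𝓡 m) X Y x)

/-- The Frobenius integrability condition `ψ ∧ dψ = 0` for a one-form `ψ`. -/
def FrobeniusIntegrable (ψ : (x : M) → TangentSpace (𝓡 m) x →L[ℝ] ℝ) : Prop :=
  ∀ (x : M) (X Y Z : (x : M) → TangentSpace (𝓡 m) x),
    VFieldDiffAt X x → VFieldDiffAt Y x → VFieldDiffAt Z x →
      ψ x (X x) * oneFormExtDeriv ψ Y Z x + ψ x (Y x) * oneFormExtDeriv ψ Z X x
        + ψ x (Z x) * oneFormExtDeriv ψ X Y x = 0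

variable (m M) in
/-- A smooth Lorentzian metric of signature `(-, +, …, +)`: a smooth field of symmetric bilinear
forms, each of which has a timelike vector on whose orthogonal complement it is positive
definite. -/
structure LorentzianMetric where
  /-- The scalar product on the tangent spaces. -/
  val (x : M) : TangentSpace (𝓡 m) x →L[ℝ] TangentSpace (𝓡 m) x →L[ℝ] ℝ
  symm (x : M) (v w : TangentSpace (𝓡 m) x) : val x v w = val x w v
  lorentzian (x : M) : ∃ T : TangentSpace (𝓡 m) x, val x T T < 0 ∧
    ∀ v : TangentSpace (𝓡 m) x, val x T v = 0 → v ≠ 0 → 0 < val x v v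
  smooth : ContMDiff (𝓡 m) ((𝓡 m).prod 𝓘(ℝ, EuclideanSpace ℝ (Fin m) →L[ℝ]
      EuclideanSpace ℝ (Fin m) →L[ℝ] ℝ)) ∞
    (fun x => Bundle.TotalSpace.mk' (EuclideanSpace ℝ (Fin m) →L[ℝ]
      EuclideanSpace ℝ (Fin m) →L[ℝ] ℝ)
      (E := fun x : M => TangentSpace (𝓡 m) x →L[ℝ] TangentSpace (𝓡 m) x →L[ℝ] ℝ) x (val x))

/-- `ξ` is a Killing vector field of `g`, that is `(L_ξ g)(X, Y) = 0` for all `X`, `Y`, where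
`(L_ξ g)(X, Y) = ξ(g(X, Y)) - g([ξ, X], Y) - g(X, [ξ, Y])`. -/
def IsKilling (g : LorentzianMetric m M) (ξ : (x : M) → TangentSpace (𝓡 m) x) : Prop :=
  ∀ (x : M) (X Y : (x : M) → TangentSpace (𝓡 m) x), VFieldDiffAt X x → VFieldDiffAt Y x →
    mvfderiv (𝓡 m) (fun y => g.val y (X y) (Y y)) x (ξ x)
      - g.val x (VectorField.mlieBracket (𝓡 m) ξ X x) (Y x)
      - g.val x (X x) (VectorField.mlieBracket (𝓡 m) ξ Y x) = 0

/-- `D` is the Levi-Civita connection of `g`: it is torsion-free and `D g = 0`.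
(`D Y x v` is the covariant derivative of `Y` in the direction `v` at `x`.) -/
def IsLeviCivita (g : LorentzianMetric m M)
    (D : CovariantDerivative (𝓡 m) (EuclideanSpace ℝ (Fin m))
      (TangentSpace (𝓡 m) : M → Type _)) : Prop :=
  D.torsion = 0 ∧
    ∀ (x : M) (Y Z : (x : M) → TangentSpace (𝓡 m) x), VFieldDiffAt Y x → VFieldDiffAt Z x →
      ∀ v : TangentSpace (𝓡 m) x,
        mvfderiv (𝓡 m) (fun y => g.val y (Y y) (Z y)) x v
          = g.val x (D Y x v) (Z x) + g.val x (Y x) (D Z x v)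

/-- `ξ` is parallel with respect to the Levi-Civita connection of `g`. -/
def IsParallel (g : LorentzianMetric m M) (ξ : (x : M) → TangentSpace (𝓡 m) x) : Prop :=
  ∃ D : CovariantDerivative (𝓡 m) (EuclideanSpace ℝ (Fin m))
      (TangentSpace (𝓡 m) : M → Type _),
    IsLeviCivita g D ∧ ∀ x, D ξ x = 0

/-! ### Platonic waves -/

/-- `Ω` is a smooth positive function such that `ξ` is parallel for the conformally related metric
`g' = Ω⁻¹ g`. -/
def IsConformalFactor (g : LorentzianMetric m M) (ξ : (x : M) → TangentSpace (𝓡 m) x)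
    (Ω : M → ℝ) : Prop :=
  ContMDiff (𝓡 m) 𝓘(ℝ, ℝ) ∞ Ω ∧ (∀ x, 0 < Ω x) ∧
    ∃ g' : LorentzianMetric m M, (∀ x, g.val x = Ω x • g'.val x) ∧ IsParallel g' ξ

/-- The Lorentzian metric `g` and the vector field `ξ` form a Platonic wave: `ξ` is a (smooth,
nowhere vanishing) null Killing vector field of `g` which is parallel for a metric conformally
equivalent to `g`. -/
structure IsPlatonicWave (g : LorentzianMetric m M) (ξ : (x : M) → TangentSpace (𝓡 m) x) :
    Prop where
  smooth : VFieldSmoothOn ξ Set.univ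
  ne_zero : ∀ x, ξ x ≠ 0
  null : ∀ x, g.val x (ξ x) (ξ x) = 0
  killing : IsKilling g ξ
  conformal : ∃ Ω : M → ℝ, IsConformalFactor g ξ Ω

/-! ### Rays and the Platonic screen -/

/-- Two points lie on the same ray (orbit of `ξ`): the equivalence relation generated by
`x ∼ y` if an integral curve of `ξ` leads from `x` to `y`. -/
def raySetoid (ξ : (x : M) → TangentSpace (𝓡 m) x) : Setoid M :=
  Relation.EqvGen.setoid fun x y =>
    ∃ (γ : ℝ → M) (b : ℝ), 0 ≤ b ∧ IsMIntegralCurveOn γ ξ (Set.Icc 0 b) ∧ γ 0 = x ∧ γ b = y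

/-- The Platonic screen: the orbit space of the rays. -/
def PlatonicScreen (ξ : (x : M) → TangentSpace (𝓡 m) x) : Type _ :=
  Quotient (raySetoid ξ)

/-- The quotient topology. -/
instance PlatonicScreen.instTopologicalSpace (ξ : (x : M) → TangentSpace (𝓡 m) x) : TopologicalSpace (PlatonicScreen ξ) :=
  inferInstanceAs (TopologicalSpace (Quotient (raySetoid ξ)))

/-- The projection sending a point to its ray. -/
def screenProj (ξ : (x : M) → TangentSpace (𝓡 m) x) : M → PlatonicScreen ξ :=
  Quotient.mk (raySetoid ξ)

end Ambient

/-! ### Aristotelian structures -/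

section Aristotelian

variable {n : ℕ}

/-- An Aristotelian structure on an `n`-dimensional manifold `S`: a smooth nowhere vanishing
one-form `ψ` (the absolute clock) with `ψ ∧ dψ = 0`, and a smooth positive definite metric
(the rulers) on the kernel of `ψ`, hence a Riemannian metric on the integral hypersurfaces of
`ker ψ` (the absolute spaces). -/
structure AristotelianStructure (n : ℕ) (S : Type*) [TopologicalSpace S]
    [ChartedSpace (EuclideanSpace ℝ (Fin n)) S] [IsManifold (𝓡 n) ∞ S] where
  /-- The absolute clock. -/
  clock (x : S) : TangentSpace (𝓡 n) x →L[ℝ] ℝ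
  clock_smooth : OneFormSmooth clock
  clock_ne_zero : ∀ x, clock x ≠ 0
  clock_integrable : FrobeniusIntegrable clock
  /-- The spatial metric, on vectors in the kernel of the clock. -/
  rulers (x : S) : (clock x).ker →ₗ[ℝ] (clock x).ker →ₗ[ℝ] ℝ
  rulers_symm : ∀ (x : S) (v w : (clock x).ker), rulers x v w = rulers x w v
  rulers_pos : ∀ (x : S) (v : (clock x).ker), v ≠ 0 → 0 < rulers x v v
  rulers_smooth : ∀ (U : Set S), IsOpen U → ∀ X Y : (x : S) → (clock x).ker,
    VFieldSmoothOn (fun x => (X x : TangentSpace (𝓡 n) x)) U →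
    VFieldSmoothOn (fun x => (Y x : TangentSpace (𝓡 n) x)) U →
      ContMDiffOn (𝓡 n) 𝓘(ℝ, ℝ) ∞ (fun x => rulers x (X x) (Y x)) U

variable {S : Type*} [TopologicalSpace S] [ChartedSpace (EuclideanSpace ℝ (Fin n)) S]
  [IsManifold (𝓡 n) ∞ S]
  {W : Type*} [TopologicalSpace W] [ChartedSpace (EuclideanSpace ℝ (Fin n)) W]
  [IsManifold (𝓡 n) ∞ W]

/-- The map `f` carries the Aristotelian structure `B` to `A`: `B` is the pullback of `A` by `f`. -/
def AristotelianStructure.IsPullback (B : AristotelianStructure n W)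
    (A : AristotelianStructure n S) (f : W → S) : Prop :=
  (∀ (p : W) (v : TangentSpace (𝓡 n) p),
    B.clock p v = A.clock (f p) (mfderiv (𝓡 n) (𝓡 n) f p v)) ∧
  ∀ (p : W) (v w : (B.clock p).ker) (v' w' : (A.clock (f p)).ker),
    mfderiv (𝓡 n) (𝓡 n) f p v = v' → mfderiv (𝓡 n) (𝓡 n) f p w = w' →
      B.rulers p v w = A.rulers (f p) v' w'

variable {m : ℕ} {M : Type*} [TopologicalSpace M] [ChartedSpace (EuclideanSpace ℝ (Fin m)) M]
  [IsManifold (𝓡 m) ∞ M]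

/-- The Aristotelian structure `A` on a quotient `q : M → S` is induced from the ambient metric
`g` and the wave vector field `ξ`: the pullback of the clock to `M` is the covector field `g(ξ)`,
and the rulers measure the `g`-scalar product of any representatives in `M`. -/
def AristotelianStructure.IsInducedOnQuotient (A : AristotelianStructure n S)
    (g : LorentzianMetric m M) (ξ : (x : M) → TangentSpace (𝓡 m) x) (q : M → S) : Prop :=
  (∀ (x : M) (v : TangentSpace (𝓡 m) x),
    A.clock (q x) (mfderiv (𝓡 m) (𝓡 n) q x v) = g.val x (ξ x) v) ∧
  ∀ (x : M) (v w : TangentSpace (𝓡 m) x) (v' w' : (A.clock (q x)).ker),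
    mfderiv (𝓡 m) (𝓡 n) q x v = v' → mfderiv (𝓡 m) (𝓡 n) q x w = w' →
      A.rulers (q x) v' w' = g.val x v w

/-- The Aristotelian structure `B` on a submanifold `σ : W → M` is induced from the ambient metric
`g` and the wave vector field `ξ`: the clock is the restriction to `W` of the covector field
`g(ξ)`, and the rulers are the restriction of `g`. -/
def AristotelianStructure.IsInducedOnSubmanifold (B : AristotelianStructure n W)
    (g : LorentzianMetric m M) (ξ : (x : M) → TangentSpace (𝓡 m) x) (σ : W → M) : Prop :=
  (∀ (p : W) (v : TangentSpace (𝓡 n) p),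
    B.clock p v = g.val (σ p) (ξ (σ p)) (mfderiv (𝓡 n) (𝓡 m) σ p v)) ∧
  ∀ (p : W) (v w : (B.clock p).ker),
    B.rulers p v w
      = g.val (σ p) (mfderiv (𝓡 n) (𝓡 m) σ p v) (mfderiv (𝓡 n) (𝓡 m) σ p w)

end Aristotelian

/-- A screen worldvolume `σ : W → M`: an embedded `n`-dimensional submanifold, transverse to the
rays, which meets every ray exactly once. -/
structure IsScreenWorldvolume (n : ℕ) {m : ℕ} {M : Type*} [TopologicalSpace M]
    [ChartedSpace (EuclideanSpace ℝ (Fin m)) M] [IsManifold (𝓡 m) ∞ M]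
    {W : Type*} [TopologicalSpace W] [ChartedSpace (EuclideanSpace ℝ (Fin n)) W]
    (ξ : (x : M) → TangentSpace (𝓡 m) x) (σ : W → M) : Prop where
  embedding : Manifold.IsSmoothEmbedding (𝓡 n) (𝓡 m) ∞ σ
  transverse : ∀ p : W, ξ (σ p) ∉ (mfderiv (𝓡 n) (𝓡 m) σ p).range
  representatives : Function.Bijective fun p : W => screenProj ξ (σ p)

/-!
The metric descends to the screen because its relevant part is invariant along the rays and
insensitive to vertical vectors. The kernel of the differential of the projection `q` is spanned by
`ξ` (`exists_eq_smul_of_mfderiv_screenProj_eq_zero`). Since `ξ` is null, adding a multiple of `ξ` to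
`v` does not change `g(ξ, v)`, nor does it change `g(v, w)` if `w` is orthogonal to `ξ`. Along a ray,
a vector is extended to a field `Y` with constant projection, for which `[ξ, Y]` is vertical, that
is, a multiple of `ξ`; the Killing equation then shows that `g(ξ, Y)` is constant, and so is
`g(Y, Z)` for `Y`, `Z` orthogonal to `ξ` (`val_field_eq_of_screenProj_eq`,
`val_eq_of_screenProj_eq`).

On the orthogonal complement of a null vector a Lorentzian scalar product is positive modulo that
vector (`LorentzianMetric.pos_of_orthogonal_null`), which makes the rulers positive definite. If
`g = Ω g'` with `ξ` parallel for `g'`, then `g'(ξ)` is closed, hence locally `dτ` by the Poincaré lemma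
(`exists_eq_mvfderiv_of_closed`), and the pullback of `g(ξ) = Ω dτ` by any smooth map `f` is
`(Ω ∘ f) d(τ ∘ f)`. This gives both the Frobenius condition for the clock and the absolute time.
That `Ω` is constant along the rays follows from comparing the Killing equations of `g` and `g'`.

The structures on the screen and on a worldvolume are both instances of
`AristotelianStructure.ofLift`, which measures linear lifts of tangent vectors to `M`, and whose
smoothness is checked locally on a smooth transverse map: a local section of the submersion `q` in
the first case (`exists_isInducedOnQuotient`), the worldvolume itself in the second
(`IsScreenWorldvolume.exists_isInducedOnSubmanifold`).
-/

open Set Filter Topology VectorField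

/-! ### Vector fields in charts -/

section Charts

variable {m : ℕ} {M : Type*} [TopologicalSpace M] [ChartedSpace (EuclideanSpace ℝ (Fin m)) M]
  [IsManifold (𝓡 m) ∞ M]
  {φ : OpenPartialHomeomorph M (EuclideanSpace ℝ (Fin m))} {x : M}
  {X Y : (x : M) → TangentSpace (𝓡 m) x}

/-- The coordinate vector field with constant components `a` in the chart `φ`. It is meaningful on the
source of `φ` only. -/
noncomputable def chartField (φ : OpenPartialHomeomorph M (EuclideanSpace ℝ (Fin m)))
    (a : EuclideanSpace ℝ (Fin m)) : (x : M) → TangentSpace (𝓡 m) x :=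
  mpullback (𝓡 m) (𝓡 m) φ (fun _ => a)

/-- The components of the vector field `X` in the chart `φ`, as a function of the coordinates. It
is meaningful on the target of `φ` only. -/
noncomputable def chartRep (φ : OpenPartialHomeomorph M (EuclideanSpace ℝ (Fin m)))
    (X : (x : M) → TangentSpace (𝓡 m) x) : EuclideanSpace ℝ (Fin m) → EuclideanSpace ℝ (Fin m) :=
  fun z => mfderiv (𝓡 m) (𝓡 m) φ (φ.symm z) (X (φ.symm z))

lemma two_le_infty : (2 : WithTop ℕ∞) ≤ ∞ :=
  WithTop.coe_le_coe.2 (le_top : (2 : ℕ∞) ≤ ⊤)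

omit [IsManifold (𝓡 m) ∞ M] in
lemma mdifferentiable_of_mem_maximalAtlas (hφ : φ ∈ IsManifold.maximalAtlas (𝓡 m) ∞ M) :
    φ.MDifferentiable (𝓡 m) (𝓡 m) :=
  ⟨fun _ hx => ((contMDiffOn_of_mem_maximalAtlas hφ).mdifferentiableOn (by simp)) _ hx,
    fun _ hx => ((contMDiffOn_symm_of_mem_maximalAtlas hφ).mdifferentiableOn (by simp)) _ hx⟩

omit [IsManifold (𝓡 m) ∞ M] in
lemma isInvertible_mfderiv_chart (hφ : φ ∈ IsManifold.maximalAtlas (𝓡 m) ∞ M)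
    (hx : x ∈ φ.source) : (mfderiv (𝓡 m) (𝓡 m) φ x).IsInvertible :=
  ⟨(mdifferentiable_of_mem_maximalAtlas hφ).mfderiv hx, rfl⟩

omit [IsManifold (𝓡 m) ∞ M] in
lemma isInvertible_mfderiv_chart_symm (hφ : φ ∈ IsManifold.maximalAtlas (𝓡 m) ∞ M)
    {z : EuclideanSpace ℝ (Fin m)} (hz : z ∈ φ.target) :
    (mfderiv (𝓡 m) (𝓡 m) φ.symm z).IsInvertible :=
  ⟨(mdifferentiable_of_mem_maximalAtlas hφ).symm.mfderiv hz, rfl⟩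

omit [IsManifold (𝓡 m) ∞ M] in
lemma mfderiv_chartField (hφ : φ ∈ IsManifold.maximalAtlas (𝓡 m) ∞ M) (hx : x ∈ φ.source)
    (a : EuclideanSpace ℝ (Fin m)) :
    mfderiv (𝓡 m) (𝓡 m) φ x (chartField φ a x) = a :=
  (isInvertible_mfderiv_chart hφ hx).self_apply_inverse a

omit [IsManifold (𝓡 m) ∞ M] in
lemma chartField_mfderiv (hφ : φ ∈ IsManifold.maximalAtlas (𝓡 m) ∞ M) (hx : x ∈ φ.source)
    (v : TangentSpace (𝓡 m) x) :
    chartField φ (mfderiv (𝓡 m) (𝓡 m) φ x v) x = v :=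
  (isInvertible_mfderiv_chart hφ hx).inverse_apply_self v

lemma contMDiffAt_chartField (hφ : φ ∈ IsManifold.maximalAtlas (𝓡 m) ∞ M) (hx : x ∈ φ.source)
    (a : EuclideanSpace ℝ (Fin m)) :
    ContMDiffAt (𝓡 m) (𝓡 m).tangent ∞
      (fun y => (⟨y, chartField φ a y⟩ : TangentBundle (𝓡 m) M)) x := by
  refine ContMDiffAt.mpullback_vectorField_preimage (n := ∞) ?_
    (contMDiffAt_of_mem_maximalAtlas hφ hx) (isInvertible_mfderiv_chart hφ hx) (by simp)
  exact contMDiffAt_vectorSpace_iff_contDiffAt.2 contDiffAt_const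

omit [IsManifold (𝓡 m) ∞ M] in
lemma chartRep_apply (hx : x ∈ φ.source) :
    chartRep φ X (φ x) = mfderiv (𝓡 m) (𝓡 m) φ x (X x) := by
  rw [chartRep, φ.left_inv hx]

lemma differentiableAt_chartRep (hφ : φ ∈ IsManifold.maximalAtlas (𝓡 m) ∞ M) (hx : x ∈ φ.source)
    (hX : VFieldDiffAt X x) : DifferentiableAt ℝ (chartRep φ X) (φ x) := by
  have hx' : φ x ∈ φ.target := φ.map_source hx
  have h1 : MDifferentiableAt (𝓡 m) (𝓡 m).tangent
      (fun z => (⟨z, mpullback (𝓡 m) (𝓡 m) φ.symm X z⟩ :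
        TangentBundle (𝓡 m) (EuclideanSpace ℝ (Fin m)))) (φ x) := by
    refine MDifferentiableAt.mpullback_vectorField (n := ∞) ?_
      (contMDiffAt_symm_of_mem_maximalAtlas hφ hx') (isInvertible_mfderiv_chart_symm hφ hx')
      two_le_infty
    rw [φ.left_inv hx]
    exact hX
  have h2 : MDifferentiableAt (𝓡 m) 𝓘(ℝ, EuclideanSpace ℝ (Fin m))
      (fun z => mpullback (𝓡 m) (𝓡 m) φ.symm X z) (φ x) :=
    ((contMDiff_snd_tangentBundle_modelSpace (n := 1) (EuclideanSpace ℝ (Fin m))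
      (𝓡 m)).mdifferentiable (by simp) _).comp (φ x) h1
  refine h2.differentiableAt.congr_of_eventuallyEq ?_
  filter_upwards [φ.open_target.mem_nhds hx'] with z hz
  have hz' := φ.map_target hz
  -- the inverse of the differential of `φ⁻¹` is the differential of `φ`
  have h3 := (isInvertible_mfderiv_chart_symm hφ hz).inverse_apply_self
    (mfderiv (𝓡 m) (𝓡 m) φ (φ.symm z) (X (φ.symm z)))
  have h4 : mfderiv (𝓡 m) (𝓡 m) φ.symm z (mfderiv (𝓡 m) (𝓡 m) φ (φ.symm z) (X (φ.symm z)))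
      = X (φ.symm z) := by
    have h (w : EuclideanSpace ℝ (Fin m)) (hw : w = φ (φ.symm z)) :
        mfderiv (𝓡 m) (𝓡 m) φ.symm w (mfderiv (𝓡 m) (𝓡 m) φ (φ.symm z) (X (φ.symm z)))
          = X (φ.symm z) := by
      subst hw
      exact congrArg (fun L => L (X (φ.symm z)))
        ((mdifferentiable_of_mem_maximalAtlas hφ).symm_comp_deriv hz')
    exact h z (φ.right_inv hz).symm
  refine (h3.symm.trans ?_)
  exact congrArg (mfderiv (𝓡 m) (𝓡 m) φ.symm z).inverse h4

omit [IsManifold (𝓡 m) ∞ M] in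
lemma eventuallyEq_mpullback_chartRep (hφ : φ ∈ IsManifold.maximalAtlas (𝓡 m) ∞ M)
    (hx : x ∈ φ.source) :
    ∀ᶠ y in 𝓝 x, X y = mpullback (𝓡 m) (𝓡 m) φ (chartRep φ X) y := by
  filter_upwards [φ.open_source.mem_nhds hx] with y hy
  have h1 := chartField_mfderiv hφ hy (X y)
  have h2 : chartRep φ X (φ y) = mfderiv (𝓡 m) (𝓡 m) φ y (X y) := chartRep_apply hy
  exact (h1.symm.trans (congrArg (mfderiv (𝓡 m) (𝓡 m) φ y).inverse h2.symm))

/-- The coordinate expression of the Lie bracket. -/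
lemma mfderiv_mlieBracket (hφ : φ ∈ IsManifold.maximalAtlas (𝓡 m) ∞ M) (hx : x ∈ φ.source)
    (hX : VFieldDiffAt X x) (hY : VFieldDiffAt Y x) :
    mfderiv (𝓡 m) (𝓡 m) φ x (mlieBracket (𝓡 m) X Y x)
      = fderiv ℝ (chartRep φ Y) (φ x) (chartRep φ X (φ x))
        - fderiv ℝ (chartRep φ X) (φ x) (chartRep φ Y (φ x)) := by
  have : IsManifold (𝓡 m) (minSmoothness ℝ 2) M := .of_le (n := ∞) (by simpa using two_le_infty)
  have h1 : mlieBracket (𝓡 m) X Y x = mlieBracket (𝓡 m) (mpullback (𝓡 m) (𝓡 m) φ (chartRep φ X))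
      (mpullback (𝓡 m) (𝓡 m) φ (chartRep φ Y)) x :=
    Filter.EventuallyEq.mlieBracket_vectorField_eq (eventuallyEq_mpullback_chartRep hφ hx)
      (eventuallyEq_mpullback_chartRep hφ hx)
  have h2 (Z : (x : M) → TangentSpace (𝓡 m) x) (hZ : VFieldDiffAt Z x) :
      MDifferentiableAt (𝓡 m) (𝓡 m).tangent (fun z => (⟨z, chartRep φ Z z⟩ :
        TangentBundle (𝓡 m) (EuclideanSpace ℝ (Fin m)))) (φ x) := by
    refine (mdifferentiableAt_totalSpace _ _).2 ⟨mdifferentiableAt_id, ?_⟩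
    convert! (differentiableAt_chartRep hφ hx hZ).mdifferentiableAt with y
    simp
  have h3 := mpullback_mlieBracket (n := ∞) (h2 X hX) (h2 Y hY)
    (contMDiffAt_of_mem_maximalAtlas hφ hx) (by simpa using two_le_infty)
  rw [h1, ← h3]
  -- what remains is the bracket of vector fields on the model space
  refine ((isInvertible_mfderiv_chart hφ hx).self_apply_inverse _).trans ?_
  refine (congrFun (mlieBracketWithin_eq_lieBracketWithin (s := univ)) (φ x)).trans ?_
  rw [lieBracketWithin_univ]
  rfl

omit [IsManifold (𝓡 m) ∞ M] in
lemma chartRep_chartField (hφ : φ ∈ IsManifold.maximalAtlas (𝓡 m) ∞ M)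
    (a : EuclideanSpace ℝ (Fin m)) {z : EuclideanSpace ℝ (Fin m)} (hz : z ∈ φ.target) :
    chartRep φ (chartField φ a) z = a :=
  mfderiv_chartField hφ (φ.map_target hz) a

omit [IsManifold (𝓡 m) ∞ M] in
/-- The chain rule for a function given in the chart `φ` by `G`. -/
lemma hasMFDerivAt_of_chart (hφ : φ ∈ IsManifold.maximalAtlas (𝓡 m) ∞ M) (hx : x ∈ φ.source)
    {f : M → ℝ} {G : EuclideanSpace ℝ (Fin m) → ℝ} {G' : EuclideanSpace ℝ (Fin m) →L[ℝ] ℝ}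
    (hG : HasFDerivAt G G' (φ x)) (hf : ∀ᶠ y in 𝓝 x, f y = G (φ y)) :
    MDifferentiableAt (𝓡 m) 𝓘(ℝ, ℝ) f x ∧
      ∀ v : TangentSpace (𝓡 m) x, mvfderiv (𝓡 m) f x v = G' (mfderiv (𝓡 m) (𝓡 m) φ x v) := by
  have h1 : HasMFDerivAt (𝓡 m) 𝓘(ℝ, ℝ) f x (G'.comp (mfderiv (𝓡 m) (𝓡 m) φ x)) :=
    (hG.hasMFDerivAt.comp x ((mdifferentiable_of_mem_maximalAtlas hφ).mdifferentiableAt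
      hx).hasMFDerivAt).congr_of_eventuallyEq hf
  exact ⟨h1.mdifferentiableAt, fun v => congrArg (fun L => L v) h1.mfderiv⟩

end Charts

/-! ### Closed and exact one-forms -/

section ExactForms

variable {m : ℕ} {M : Type*} [TopologicalSpace M] [ChartedSpace (EuclideanSpace ℝ (Fin m)) M]
  [IsManifold (𝓡 m) ∞ M] {x : M} {X Y : (x : M) → TangentSpace (𝓡 m) x}

/-- The derivative of the function `Y t` at `x`, in the chart `φ`. -/
lemma hasMFDerivAt_mvfderiv_apply {φ : OpenPartialHomeomorph M (EuclideanSpace ℝ (Fin m))}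
    (hφ : φ ∈ IsManifold.maximalAtlas (𝓡 m) ∞ M) (hx : x ∈ φ.source) {t : M → ℝ}
    (ht : ContMDiffAt (𝓡 m) 𝓘(ℝ, ℝ) ∞ t x) (hY : VFieldDiffAt Y x) :
    MDifferentiableAt (𝓡 m) 𝓘(ℝ, ℝ) (fun y => mvfderiv (𝓡 m) t y (Y y)) x ∧
      ∀ v : TangentSpace (𝓡 m) x, mvfderiv (𝓡 m) (fun y => mvfderiv (𝓡 m) t y (Y y)) x v
        = fderiv ℝ (t ∘ φ.symm) (φ x)
            (fderiv ℝ (chartRep φ Y) (φ x) (mfderiv (𝓡 m) (𝓡 m) φ x v))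
          + fderiv ℝ (fderiv ℝ (t ∘ φ.symm)) (φ x) (mfderiv (𝓡 m) (𝓡 m) φ x v)
            (chartRep φ Y (φ x)) := by
  have hx' := φ.map_source hx
  have ht' : ContDiffAt ℝ ∞ (t ∘ φ.symm) (φ x) := by
    refine (ContMDiffAt.comp (φ x) ?_ (contMDiffAt_symm_of_mem_maximalAtlas hφ hx')).contDiffAt
    rwa [φ.left_inv hx]
  have h1 : DifferentiableAt ℝ (fderiv ℝ (t ∘ φ.symm)) (φ x) :=
    (ht'.fderiv_right (m := 1) (by simpa [one_add_one_eq_two] using two_le_infty)).differentiableAt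
      (by simp)
  have h2 := h1.hasFDerivAt.clm_apply (differentiableAt_chartRep hφ hx hY).hasFDerivAt
  have h3 : ∀ᶠ y in 𝓝 x, mvfderiv (𝓡 m) t y (Y y)
      = fderiv ℝ (t ∘ φ.symm) (φ y) (chartRep φ Y (φ y)) := by
    filter_upwards [φ.open_source.mem_nhds hx, contMDiffAt_iff_contMDiffAt_nhds
      (n := 1) (by simp) |>.1 (ht.of_le (by simp))] with y hy hty
    have hy' := φ.map_source hy
    have hd : MDifferentiableAt (𝓡 m) 𝓘(ℝ, ℝ) (t ∘ φ.symm) (φ y) :=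
      MDifferentiableAt.comp _ (by rw [φ.left_inv hy]; exact hty.mdifferentiableAt (by simp))
        ((mdifferentiable_of_mem_maximalAtlas hφ).mdifferentiableAt_symm hy')
    rw [chartRep_apply hy]
    refine (hasMFDerivAt_of_chart hφ hy hd.differentiableAt.hasFDerivAt ?_).2 (Y y)
    filter_upwards [φ.open_source.mem_nhds hy] with z hz
    simp [φ.left_inv hz]
  obtain ⟨h4, h5⟩ := hasMFDerivAt_of_chart hφ hx h2 h3
  exact ⟨h4, fun v => h5 v⟩

/-- `d(dt) = 0`, also on vector fields which are only differentiable at the point. -/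
lemma oneFormExtDeriv_mvfderiv {t : M → ℝ} (ht : ContMDiffAt (𝓡 m) 𝓘(ℝ, ℝ) ∞ t x)
    (hX : VFieldDiffAt X x) (hY : VFieldDiffAt Y x) :
    oneFormExtDeriv (mvfderiv (𝓡 m) t) X Y x = 0 := by
  have hφ := IsManifold.chart_mem_maximalAtlas (I := 𝓡 m) (n := ∞) x
  have hx := mem_chart_source (EuclideanSpace ℝ (Fin m)) x
  set φ := chartAt (EuclideanSpace ℝ (Fin m)) x
  have hx' := φ.map_source hx
  have ht' : ContDiffAt ℝ ∞ (t ∘ φ.symm) (φ x) := by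
    refine (ContMDiffAt.comp (φ x) ?_ (contMDiffAt_symm_of_mem_maximalAtlas hφ hx')).contDiffAt
    rwa [φ.left_inv hx]
  have hsymm := ht'.isSymmSndFDerivAt (by simpa using two_le_infty)
  have hd : ∀ v : TangentSpace (𝓡 m) x, mvfderiv (𝓡 m) t x v
      = fderiv ℝ (t ∘ φ.symm) (φ x) (mfderiv (𝓡 m) (𝓡 m) φ x v) := by
    refine (hasMFDerivAt_of_chart hφ hx (ht'.differentiableAt (by simp)).hasFDerivAt ?_).2
    filter_upwards [φ.open_source.mem_nhds hx] with z hz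
    simp [φ.left_inv hz]
  rw [oneFormExtDeriv, (hasMFDerivAt_mvfderiv_apply hφ hx ht hY).2,
    (hasMFDerivAt_mvfderiv_apply hφ hx ht hX).2, hd, mfderiv_mlieBracket hφ hx hX hY, map_sub,
    chartRep_apply hx, chartRep_apply hx,
    hsymm.eq (mfderiv (𝓡 m) (𝓡 m) φ x (X x)) (mfderiv (𝓡 m) (𝓡 m) φ x (Y x))]
  ring

/-- A one-form which is locally `f dt` satisfies `ψ ∧ dψ = 0`: there `dψ = df ∧ dt`. -/
lemma frobeniusIntegrable_of_locally_smul_mvfderiv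
    {ψ : (x : M) → TangentSpace (𝓡 m) x →L[ℝ] ℝ}
    (h : ∀ x, ∃ f t : M → ℝ, ContMDiffAt (𝓡 m) 𝓘(ℝ, ℝ) ∞ f x ∧
      ContMDiffAt (𝓡 m) 𝓘(ℝ, ℝ) ∞ t x ∧ ∀ᶠ y in 𝓝 x, ψ y = f y • mvfderiv (𝓡 m) t y) :
    FrobeniusIntegrable ψ := by
  intro x X Y Z hX hY hZ
  obtain ⟨f, t, hf, ht, hψ⟩ := h x
  have hf' := hf.mdifferentiableAt (by simp)
  have key (X Y : (x : M) → TangentSpace (𝓡 m) x) (hX : VFieldDiffAt X x)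
      (hY : VFieldDiffAt Y x) : oneFormExtDeriv ψ X Y x
        = mvfderiv (𝓡 m) f x (X x) * mvfderiv (𝓡 m) t x (Y x)
          - mvfderiv (𝓡 m) f x (Y x) * mvfderiv (𝓡 m) t x (X x) := by
    have h0 := oneFormExtDeriv_mvfderiv ht hX hY
    have h1 (X Y : (x : M) → TangentSpace (𝓡 m) x) (hY : VFieldDiffAt Y x) :
        mvfderiv (𝓡 m) (fun y => ψ y (Y y)) x (X x)
          = f x * mvfderiv (𝓡 m) (fun y => mvfderiv (𝓡 m) t y (Y y)) x (X x)
            + mvfderiv (𝓡 m) t x (Y x) * mvfderiv (𝓡 m) f x (X x) := by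
      have h2 : (fun y => ψ y (Y y)) =ᶠ[𝓝 x] fun y => f y * mvfderiv (𝓡 m) t y (Y y) := by
        filter_upwards [hψ] with y hy
        rw [hy]
        rfl
      have h3 := mvfderiv_fun_mul hf' (hasMFDerivAt_mvfderiv_apply
        (IsManifold.chart_mem_maximalAtlas x) (mem_chart_source _ x) ht hY).1
      have h4 : mvfderiv (𝓡 m) (fun y => ψ y (Y y)) x
          = mvfderiv (𝓡 m) (fun y => f y * mvfderiv (𝓡 m) t y (Y y)) x := by
        rw [mvfderiv, mvfderiv, h2.mfderiv_eq]
        rfl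
      rw [h4, h3]
      rfl
    rw [oneFormExtDeriv] at h0 ⊢
    rw [h1 X Y hY, h1 Y X hX, hψ.self_of_nhds]
    simp only [smul_apply, smul_eq_mul]
    linear_combination f x * h0
  rw [key _ _ hY hZ, key _ _ hZ hX, key _ _ hX hY, hψ.self_of_nhds]
  simp only [smul_apply, smul_eq_mul]
  ring

lemma contMDiffAt_oneForm_chartField {α : (x : M) → TangentSpace (𝓡 m) x →L[ℝ] ℝ}
    (hα : OneFormSmooth α) {φ : OpenPartialHomeomorph M (EuclideanSpace ℝ (Fin m))}
    (hφ : φ ∈ IsManifold.maximalAtlas (𝓡 m) ∞ M) (hx : x ∈ φ.source)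
    (a : EuclideanSpace ℝ (Fin m)) :
    ContMDiffAt (𝓡 m) 𝓘(ℝ, ℝ) ∞ (fun y => α y (chartField φ a y)) x := by
  have h := (hα x).clm_bundle_apply (E₂ := Bundle.Trivial M ℝ) (contMDiffAt_chartField hφ hx a)
  simp only [Bundle.contMDiffAt_totalSpace] at h
  exact h.2

/-- The Poincaré lemma: a closed one-form is locally the differential of a function. -/
lemma exists_eq_mvfderiv_of_closed {α : (x : M) → TangentSpace (𝓡 m) x →L[ℝ] ℝ}
    (hα : OneFormSmooth α) (hclosed : ∀ (x : M) (X Y : (x : M) → TangentSpace (𝓡 m) x),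
      VFieldDiffAt X x → VFieldDiffAt Y x → oneFormExtDeriv α X Y x = 0) (x₀ : M) :
    ∃ (U : Set M) (τ : M → ℝ), IsOpen U ∧ x₀ ∈ U ∧ ContMDiffOn (𝓡 m) 𝓘(ℝ, ℝ) ∞ τ U ∧
      ∀ x ∈ U, α x = mvfderiv (𝓡 m) τ x := by
  have hφ := IsManifold.chart_mem_maximalAtlas (I := 𝓡 m) (n := ∞) x₀
  have hx₀ := mem_chart_source (EuclideanSpace ℝ (Fin m)) x₀
  set φ := chartAt (EuclideanSpace ℝ (Fin m)) x₀
  -- the one-form in the chart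
  let A : EuclideanSpace ℝ (Fin m) → EuclideanSpace ℝ (Fin m) →L[ℝ] ℝ := fun z =>
    (α (φ.symm z)).comp (mfderiv (𝓡 m) (𝓡 m) φ (φ.symm z)).inverse
  have hA (y : M) (hy : y ∈ φ.source) (a : EuclideanSpace ℝ (Fin m)) :
      A (φ y) a = α y (chartField φ a y) := by
    change α (φ.symm (φ y)) (chartField φ a (φ.symm (φ y))) = _
    rw [φ.left_inv hy]
  have hAsmooth : ContDiffOn ℝ ∞ A φ.target := by
    rw [contDiffOn_clm_apply]
    intro a z hz
    have h := (contMDiffAt_oneForm_chartField hα hφ (φ.map_target hz) a).comp z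
      (contMDiffAt_symm_of_mem_maximalAtlas hφ hz)
    exact h.contDiffAt.contDiffWithinAt
  have hAdiff (z : EuclideanSpace ℝ (Fin m)) (hz : z ∈ φ.target) : DifferentiableAt ℝ A z :=
    (hAsmooth.contDiffAt (φ.open_target.mem_nhds hz)).differentiableAt (by simp)
  -- coordinate fields commute, so closedness on them is the symmetry of the derivative of `A`
  have hbr (x : M) (hx : x ∈ φ.source) (a b : EuclideanSpace ℝ (Fin m)) :
      mlieBracket (𝓡 m) (chartField φ a) (chartField φ b) x = 0 := by
    have hc (a : EuclideanSpace ℝ (Fin m)) : fderiv ℝ (chartRep φ (chartField φ a)) (φ x) = 0 := by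
      have : chartRep φ (chartField φ a) =ᶠ[𝓝 (φ x)] fun _ => a := by
        filter_upwards [φ.open_target.mem_nhds (φ.map_source hx)] with z hz
        exact chartRep_chartField hφ a hz
      rw [this.fderiv_eq, fderiv_fun_const]
      rfl
    apply (isInvertible_mfderiv_chart hφ hx).injective
    rw [mfderiv_mlieBracket hφ hx ((contMDiffAt_chartField hφ hx a).mdifferentiableAt (by simp))
      ((contMDiffAt_chartField hφ hx b).mdifferentiableAt (by simp)), hc, hc, map_zero]
    exact sub_self _
  have hsymm (z : EuclideanSpace ℝ (Fin m)) (hz : z ∈ φ.target) (a b : EuclideanSpace ℝ (Fin m)) :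
      fderiv ℝ A z a b = fderiv ℝ A z b a := by
    obtain ⟨x, hx, rfl⟩ : ∃ x ∈ φ.source, φ x = z := ⟨φ.symm z, φ.map_target hz, φ.right_inv hz⟩
    have hd (a b : EuclideanSpace ℝ (Fin m)) :
        mvfderiv (𝓡 m) (fun y => α y (chartField φ b y)) x (chartField φ a x)
          = fderiv ℝ A (φ x) a b := by
      have h1 := (hAdiff _ hz).hasFDerivAt.clm_apply (hasFDerivAt_const b (φ x))
      have h2 := (hasMFDerivAt_of_chart hφ hx (f := fun y => α y (chartField φ b y)) h1 (by
        filter_upwards [φ.open_source.mem_nhds hx] with y hy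
        exact (hA y hy b).symm)).2 (chartField φ a x)
      rw [h2, mfderiv_chartField hφ hx]
      simp
    have h := hclosed x (chartField φ a) (chartField φ b)
      ((contMDiffAt_chartField hφ hx a).mdifferentiableAt (by simp))
      ((contMDiffAt_chartField hφ hx b).mdifferentiableAt (by simp))
    rw [oneFormExtDeriv, hbr x hx, hd, hd, map_zero] at h
    linarith
  obtain ⟨r, hr, hball⟩ := Metric.isOpen_iff.1 φ.open_target (φ x₀) (φ.map_source hx₀)
  obtain ⟨f, hf⟩ := (convex_ball (φ x₀) r).exists_forall_hasFDerivAt_of_fderiv_symmetric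
    Metric.isOpen_ball (fun z hz => (hAdiff z (hball hz)).differentiableWithinAt)
    (fun z hz => hsymm z (hball hz))
  have hfs : ContDiffOn ℝ ∞ f (Metric.ball (φ x₀) r) := by
    refine (contDiffOn_infty_iff_fderiv_of_isOpen Metric.isOpen_ball).2
      ⟨fun z hz => (hf z hz).differentiableAt.differentiableWithinAt, ?_⟩
    exact (hAsmooth.mono hball).congr fun z hz => (hf z hz).fderiv
  refine ⟨φ.source ∩ φ ⁻¹' Metric.ball (φ x₀) r, f ∘ φ,
    φ.isOpen_inter_preimage Metric.isOpen_ball, ⟨hx₀, Metric.mem_ball_self hr⟩, ?_, ?_⟩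
  · exact hfs.contMDiffOn.comp ((contMDiffOn_of_mem_maximalAtlas hφ).mono inter_subset_left)
      fun y hy => hy.2
  · intro x hx
    ext v
    rw [(hasMFDerivAt_of_chart hφ hx.1 (f := f ∘ φ) (hf _ hx.2) (by simp)).2 v]
    refine Eq.trans ?_ (hA x hx.1 _).symm
    rw [chartField_mfderiv hφ hx.1]

end ExactForms

/-! ### Submersions, immersions and diffeomorphisms -/

section NormalForms

variable {m n : ℕ} {M : Type*} [TopologicalSpace M] [ChartedSpace (EuclideanSpace ℝ (Fin m)) M]
  [IsManifold (𝓡 m) ∞ M] {S : Type*} [TopologicalSpace S]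
  [ChartedSpace (EuclideanSpace ℝ (Fin n)) S]
  {F : Type*} [NormedAddCommGroup F] [NormedSpace ℝ F] {q : M → S} {x : M}

namespace Manifold.IsSubmersionAtOfComplement

omit [IsManifold (𝓡 m) ∞ M] in
lemma codChart_apply (h : IsSubmersionAtOfComplement F (𝓡 m) (𝓡 n) ∞ q x) {y : M}
    (hy : y ∈ h.domChart.source) : h.codChart (q y) = (h.equiv (h.domChart y)).1 := by
  have h1 := h.writtenInCharts 
    (show h.domChart y ∈ (h.domChart.extend (𝓡 m)).target by simpa using h.domChart.map_source hy)
  simpa [h.domChart.left_inv hy] using h1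

omit [IsManifold (𝓡 m) ∞ M] in
/-- A submersion has a smooth local section through every point. -/
lemma exists_section [IsManifold (𝓡 n) ∞ S]
    (h : IsSubmersionAtOfComplement F (𝓡 m) (𝓡 n) ∞ q x) :
    ∃ σ : S → M, σ (q x) = x ∧
      ∀ᶠ s in 𝓝 (q x), ContMDiffAt (𝓡 n) (𝓡 m) ∞ σ s ∧ q (σ s) = s := by
  let j : EuclideanSpace ℝ (Fin n) → EuclideanSpace ℝ (Fin m) :=
    fun u => h.equiv.symm (u, (h.equiv (h.domChart x)).2)
  have hj : ContDiff ℝ ∞ j := h.equiv.symm.contDiff.comp (contDiff_prodMk_left _)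
  have hx := h.mem_domChart_source
  have hj0 : j (h.codChart (q x)) = h.domChart x := by
    simp [j, h.codChart_apply hx]
  have hjc (s : S) (hs : s ∈ h.codChart.source) :
      ContMDiffAt (𝓡 n) (𝓡 m) ∞ (fun s => j (h.codChart s)) s :=
    hj.contMDiff.contMDiffAt.comp _ (contMDiffAt_of_mem_maximalAtlas h.codChart_mem_maximalAtlas hs)
  refine ⟨fun s => h.domChart.symm (j (h.codChart s)), ?_, ?_⟩
  · simp [hj0, h.domChart.left_inv hx]
  · have h1 : ∀ᶠ s in 𝓝 (q x), j (h.codChart s) ∈ h.domChart.target := by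
      refine (hjc _ h.mem_codChart_source).continuousAt.eventually_mem
        (h.domChart.open_target.mem_nhds ?_)
      rw [hj0]
      exact h.domChart.map_source hx
    filter_upwards [h1, h.codChart.open_source.mem_nhds h.mem_codChart_source] with s hs hs'
    refine ⟨ContMDiffAt.comp s
      (contMDiffAt_symm_of_mem_maximalAtlas h.domChart_mem_maximalAtlas hs) (hjc s hs'), ?_⟩
    have h2 := h.domChart.map_target hs
    apply h.codChart.injOn (h.source_subset_preimage_source h2) hs'
    rw [h.codChart_apply h2, h.domChart.right_inv hs]
    simp [j]

omit [IsManifold (𝓡 m) ∞ M] in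
lemma mfderiv_codChart [IsManifold (𝓡 n) ∞ S]
    (h : IsSubmersionAtOfComplement F (𝓡 m) (𝓡 n) ∞ q x) {y : M}
    (hy : y ∈ h.domChart.source) (v : TangentSpace (𝓡 m) y) :
    mfderiv (𝓡 n) (𝓡 n) h.codChart (q y) (mfderiv (𝓡 m) (𝓡 n) q y v)
      = (h.equiv (mfderiv (𝓡 m) (𝓡 m) h.domChart y v)).1 := by
  have hd := mdifferentiable_of_mem_maximalAtlas h.domChart_mem_maximalAtlas
  have hc := mdifferentiable_of_mem_maximalAtlas h.codChart_mem_maximalAtlas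
  have hqy : MDifferentiableAt (𝓡 m) (𝓡 n) q y :=
    (h.contMDiffOn.contMDiffAt (h.domChart.open_source.mem_nhds hy)).mdifferentiableAt (by simp)
  have h1 : h.codChart ∘ q =ᶠ[𝓝 y]
      ((ContinuousLinearMap.fst ℝ _ _).comp h.equiv.toContinuousLinearMap) ∘ h.domChart := by
    filter_upwards [h.domChart.open_source.mem_nhds hy] with z hz
    exact h.codChart_apply hz
  have h2 := h1.mfderiv_eq (I := 𝓡 m) (I' := 𝓡 n)
  have h3 := mfderiv_comp y (hc.mdifferentiableAt (h.source_subset_preimage_source hy)) hqy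
  have h4 := (ContinuousLinearMap.hasMFDerivAt ((ContinuousLinearMap.fst ℝ _ _).comp
    h.equiv.toContinuousLinearMap) (x := h.domChart y)).comp y (hd.mdifferentiableAt hy).hasMFDerivAt
  exact congrArg (fun L => L v) (h3.symm.trans (h2.trans h4.mfderiv))

/-- Every tangent vector `v` of the base of a submersion lifts to a vector field `Y` which projects
to `v` along the fibre and whose bracket with the vertical vector field `ξ` is vertical at `x`. In
the charts of the normal form of `q` it is a constant field, and the components of `ξ` lie in a constant subspace. -/
lemma exists_lift [IsManifold (𝓡 n) ∞ S]
    (h : IsSubmersionAtOfComplement F (𝓡 m) (𝓡 n) ∞ q x)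
    {ξ : (x : M) → TangentSpace (𝓡 m) x} (hξ : VFieldDiffAt ξ x)
    (hξq : ∀ y, mfderiv (𝓡 m) (𝓡 n) q y (ξ y) = 0) (v : EuclideanSpace ℝ (Fin n)) :
    ∃ Y : (x : M) → TangentSpace (𝓡 m) x,
      ContMDiffAt (𝓡 m) (𝓡 m).tangent ∞ (fun y => (⟨y, Y y⟩ : TangentBundle (𝓡 m) M)) x ∧
      (∀ᶠ y in 𝓝 x, q y = q x → mfderiv (𝓡 m) (𝓡 n) q y (Y y) = v) ∧
      mfderiv (𝓡 m) (𝓡 n) q x (mlieBracket (𝓡 m) ξ Y x) = 0 := by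
  have hd := h.domChart_mem_maximalAtlas
  have hx := h.mem_domChart_source
  have hc (y : M) (hy : y ∈ h.domChart.source) :=
    isInvertible_mfderiv_chart h.codChart_mem_maximalAtlas (h.source_subset_preimage_source hy)
  let a : EuclideanSpace ℝ (Fin m) :=
    h.equiv.symm (mfderiv (𝓡 n) (𝓡 n) h.codChart (q x) v, 0)
  have hY := contMDiffAt_chartField hd hx a
  refine ⟨chartField h.domChart a, hY, ?_, ?_⟩
  · filter_upwards [h.domChart.open_source.mem_nhds hx] with y hy hqy
    apply (hc y hy).injective
    rw [h.mfderiv_codChart hy, mfderiv_chartField hd hy, hqy]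
    simp [a]
  · apply (hc x hx).injective
    rw [h.mfderiv_codChart hx, mfderiv_mlieBracket hd hx hξ (hY.mdifferentiableAt (by simp)),
      map_zero]
    have h1 : fderiv ℝ (chartRep h.domChart (chartField h.domChart a)) (h.domChart x) = 0 := by
      have : chartRep h.domChart (chartField h.domChart a) =ᶠ[𝓝 (h.domChart x)] fun _ => a := by
        filter_upwards [h.domChart.open_target.mem_nhds (h.domChart.map_source hx)] with z hz
        exact chartRep_chartField hd a hz
      rw [this.fderiv_eq, fderiv_fun_const]
      rfl
    let P := (ContinuousLinearMap.fst ℝ _ _).comp h.equiv.toContinuousLinearMap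
    -- the components of a vertical field stay in the kernel of the linear projection `P`
    have h2 : P.comp (fderiv ℝ (chartRep h.domChart ξ) (h.domChart x)) = 0 := by
      have h3 : (fun z => P (chartRep h.domChart ξ z)) =ᶠ[𝓝 (h.domChart x)] fun _ => 0 := by
        filter_upwards [h.domChart.open_target.mem_nhds (h.domChart.map_source hx)] with z hz
        have h4 := h.mfderiv_codChart (h.domChart.map_target hz) (ξ (h.domChart.symm z))
        rw [hξq, map_zero] at h4
        exact h4.symm
      have h5 := P.hasFDerivAt.comp (h.domChart x)
        (differentiableAt_chartRep hd hx hξ).hasFDerivAt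
      rw [← h5.fderiv]
      exact h3.fderiv_eq.trans (by rw [fderiv_fun_const]; rfl)
    have h6 : P (fderiv ℝ (chartRep h.domChart ξ) (h.domChart x)
        (chartRep h.domChart (chartField h.domChart a) (h.domChart x))) = 0 :=
      DFunLike.congr_fun h2 _
    rw [h1]
    refine Eq.trans ?_ ((congrArg Neg.neg h6).trans neg_zero)
    change P _ = _
    rw [zero_apply, zero_sub, map_neg]

end Manifold.IsSubmersionAtOfComplement

omit [IsManifold (𝓡 m) ∞ M] in
lemma Manifold.IsImmersionAtOfComplement.mfderiv_injective [IsManifold (𝓡 n) ∞ S] {σ : S → M}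
    {p : S} (h : IsImmersionAtOfComplement F (𝓡 n) (𝓡 m) ∞ σ p) :
    Function.Injective (mfderiv (𝓡 n) (𝓡 m) σ p) := by
  -- in the charts of the normal form, `r` is the linear projection, a left inverse of `σ`
  let r : M → S := fun x => h.domChart.symm (h.equiv.symm (h.codChart x)).1
  have hp := h.mem_domChart_source
  have hσ (y : S) (hy : y ∈ h.domChart.source) :
      h.codChart (σ y) = h.equiv (h.domChart y, 0) := by
    have h1 := h.writtenInCharts
      (show h.domChart y ∈ (h.domChart.extend (𝓡 n)).target by simpa using h.domChart.map_source hy)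
    simpa [h.domChart.left_inv hy] using h1
  have hr : r ∘ σ =ᶠ[𝓝 p] id := by
    filter_upwards [h.domChart.open_source.mem_nhds hp] with y hy
    simp [r, hσ y hy, h.domChart.left_inv hy]
  have hrd : MDifferentiableAt (𝓡 m) (𝓡 n) r (σ p) := by
    have h1 : MDifferentiableAt (𝓡 m) (𝓡 m) h.codChart (σ p) :=
      (mdifferentiable_of_mem_maximalAtlas h.codChart_mem_maximalAtlas).mdifferentiableAt
        h.mem_codChart_source
    have h2 : MDifferentiableAt (𝓡 m) (𝓡 n)
        (fun x => (h.equiv.symm (h.codChart x)).1) (σ p) :=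
      (((ContinuousLinearMap.fst ℝ _ _).comp
        h.equiv.symm.toContinuousLinearMap).mdifferentiableAt).comp _ h1
    refine MDifferentiableAt.comp (σ p) ?_ h2
    refine (mdifferentiable_of_mem_maximalAtlas h.domChart_mem_maximalAtlas).mdifferentiableAt_symm
      ?_
    simpa [hσ p hp] using h.domChart.map_source hp
  have h3 := (mfderiv_comp p hrd (h.contMDiffAt.mdifferentiableAt (by simp))).symm.trans
    (hr.mfderiv_eq.trans mfderiv_id)
  exact Function.LeftInverse.injective (g := mfderiv (𝓡 m) (𝓡 n) r (σ p))
    fun v => congrArg (fun L => L v) h3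

/-- A bijective smooth map whose differentials are bijective is a diffeomorphism. -/
lemma exists_diffeomorph_of_bijective {W : Type*} [TopologicalSpace W]
    [ChartedSpace (EuclideanSpace ℝ (Fin n)) W] [IsManifold (𝓡 n) ∞ W] [IsManifold (𝓡 n) ∞ S]
    {f : W → S} (hf : ContMDiff (𝓡 n) (𝓡 n) ∞ f) (hbij : Function.Bijective f)
    (hd : ∀ p, Function.Bijective (mfderiv (𝓡 n) (𝓡 n) f p)) :
    ∃ Φ : Diffeomorph (𝓡 n) (𝓡 n) W S ∞, ∀ p, Φ p = f p := by
  refine ⟨⟨Equiv.ofBijective f hbij, hf, fun s => ?_⟩, fun p => rfl⟩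
  obtain ⟨p, rfl⟩ := hbij.2 s
  have hφ := IsManifold.chart_mem_maximalAtlas (I := 𝓡 n) (n := ∞) p
  have hψ := IsManifold.chart_mem_maximalAtlas (I := 𝓡 n) (n := ∞) (f p)
  have hp := mem_chart_source (EuclideanSpace ℝ (Fin n)) p
  have hfp := mem_chart_source (EuclideanSpace ℝ (Fin n)) (f p)
  set φ := chartAt (EuclideanSpace ℝ (Fin n)) p
  set ψ := chartAt (EuclideanSpace ℝ (Fin n)) (f p)
  have hp' := φ.map_source hp
  let F : EuclideanSpace ℝ (Fin n) → EuclideanSpace ℝ (Fin n) := fun z => ψ (f (φ.symm z))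
  have hF0 : F (φ p) = ψ (f p) := by simp [F, φ.left_inv hp]
  have hφc := contMDiffAt_symm_of_mem_maximalAtlas hφ hp'
  have hF : ContDiffAt ℝ ∞ F (φ p) := by
    refine (ContMDiffAt.comp (φ p) ?_ (hf.contMDiffAt.comp (φ p) hφc)).contDiffAt
    rw [Function.comp_apply, φ.left_inv hp]
    exact contMDiffAt_of_mem_maximalAtlas hψ hfp
  have hFd : Function.Bijective (fderiv ℝ F (φ p)) := by
    have h1 : MDifferentiableAt (𝓡 n) (𝓡 n) f (φ.symm (φ p)) := hf.mdifferentiableAt (by simp)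
    have h2 : f (φ.symm (φ p)) ∈ ψ.source := by rwa [φ.left_inv hp]
    have hψd := mdifferentiable_of_mem_maximalAtlas hψ
    have hφd := mdifferentiable_of_mem_maximalAtlas hφ
    have h3 := ((hψd.mdifferentiableAt h2).hasMFDerivAt.comp _ h1.hasMFDerivAt).comp _
      (hφd.mdifferentiableAt_symm hp').hasMFDerivAt
    rw [← mfderiv_eq_fderiv, show mfderiv (𝓡 n) (𝓡 n) F (φ p) = _ from h3.mfderiv]
    exact ((hψd.mfderiv_bijective h2).comp (hd _)).comp (hφd.symm.mfderiv_bijective hp')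
  let e : EuclideanSpace ℝ (Fin n) ≃L[ℝ] EuclideanSpace ℝ (Fin n) :=
    (LinearEquiv.ofBijective (fderiv ℝ F (φ p)).toLinearMap hFd).toContinuousLinearEquiv
  have he : HasFDerivAt F (e : EuclideanSpace ℝ (Fin n) →L[ℝ] EuclideanSpace ℝ (Fin n)) (φ p) := by
    rw [show (e : EuclideanSpace ℝ (Fin n) →L[ℝ] EuclideanSpace ℝ (Fin n)) = fderiv ℝ F (φ p) from
      ContinuousLinearMap.ext fun _ => rfl]
    exact (hF.differentiableAt (by simp)).hasFDerivAt
  let G := hF.localInverse he (by simp)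
  have hG : ContDiffAt ℝ ∞ G (F (φ p)) := hF.to_localInverse he (by simp)
  have hG0 : G (F (φ p)) = φ p := hF.localInverse_apply_image he (by simp)
  have hGr : ∀ᶠ z in 𝓝 (F (φ p)), F (G z) = z :=
    (hF.hasStrictFDerivAt' he (by simp)).eventually_right_inverse
  rw [hF0] at hG hG0 hGr
  have hGψ : ContMDiffAt (𝓡 n) (𝓡 n) ∞ (fun s => G (ψ s)) (f p) :=
    hG.contMDiffAt.comp _ (contMDiffAt_of_mem_maximalAtlas hψ hfp)
  have hloc : ContMDiffAt (𝓡 n) (𝓡 n) ∞ (fun s => φ.symm (G (ψ s))) (f p) := by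
    refine ContMDiffAt.comp (f p) ?_ hGψ
    rw [hG0]
    exact hφc
  refine hloc.congr_of_eventuallyEq ?_
  have hmem : ∀ᶠ s in 𝓝 (f p), f (φ.symm (G (ψ s))) ∈ ψ.source := by
    refine (hf.continuous.continuousAt.comp hloc.continuousAt).eventually_mem
      (ψ.open_source.mem_nhds ?_)
    simpa [hG0, φ.left_inv hp] using hfp
  have hψc : ContinuousAt ψ (f p) := ψ.continuousAt hfp
  filter_upwards [hmem, ψ.open_source.mem_nhds hfp, hψc.eventually hGr] with s h1 h2 h3
  refine (Equiv.symm_apply_eq _).2 ?_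
  exact (ψ.injOn h1 h2 h3).symm

end NormalForms

/-! ### The Lorentzian metric and its conformal factors -/

section Metric

variable {m : ℕ} {M : Type*} [TopologicalSpace M] [ChartedSpace (EuclideanSpace ℝ (Fin m)) M]
  [IsManifold (𝓡 m) ∞ M] {g : LorentzianMetric m M} {ξ : (x : M) → TangentSpace (𝓡 m) x}

/-- On the orthogonal complement of a null vector `u`, a Lorentzian scalar product is positive
except on the multiples of `u`. -/
lemma LorentzianMetric.pos_of_orthogonal_null (g : LorentzianMetric m M) {x : M}
    {u v : TangentSpace (𝓡 m) x} (hu : u ≠ 0) (hnull : g.val x u u = 0) (huv : g.val x u v = 0)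
    (hv : ∀ c : ℝ, v ≠ c • u) : 0 < g.val x v v := by
  obtain ⟨T, -, hT⟩ := g.lorentzian x
  have hTu : g.val x T u ≠ 0 := fun h => (hT u h hu).ne' hnull
  -- subtracting a multiple of `u` makes `v` orthogonal to `T` and does not change its square
  have h1 := hT (v - (g.val x T v / g.val x T u) • u) (by
    rw [map_sub, map_smul, smul_eq_mul, div_mul_cancel₀ _ hTu, sub_self]) (sub_ne_zero.2 (hv _))
  simpa [hnull, huv, g.symm x v u] using h1

lemma LorentzianMetric.exists_ne_zero_of_null (g : LorentzianMetric m M) {x : M}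
    {u : TangentSpace (𝓡 m) x} (hu : u ≠ 0) (hnull : g.val x u u = 0) :
    ∃ v, g.val x u v ≠ 0 := by
  obtain ⟨T, -, hT⟩ := g.lorentzian x
  exact ⟨T, fun h => (hT u (by rwa [g.symm]) hu).ne' hnull⟩

/-- The scalar product of two smooth vector fields along a smooth map is smooth. -/
lemma LorentzianMetric.contMDiffAt_apply (g : LorentzianMetric m M) {k : ℕ} {N : Type*}
    [TopologicalSpace N] [ChartedSpace (EuclideanSpace ℝ (Fin k)) N] {b : N → M} {p : N}
    {v w : (p : N) → TangentSpace (𝓡 m) (b p)}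
    (hv : ContMDiffAt (𝓡 k) (𝓡 m).tangent ∞
      (fun p => (⟨b p, v p⟩ : TangentBundle (𝓡 m) M)) p)
    (hw : ContMDiffAt (𝓡 k) (𝓡 m).tangent ∞
      (fun p => (⟨b p, w p⟩ : TangentBundle (𝓡 m) M)) p) :
    ContMDiffAt (𝓡 k) 𝓘(ℝ, ℝ) ∞ (fun p => g.val (b p) (v p) (w p)) p := by
  have hb : ContMDiffAt (𝓡 k) (𝓡 m) ∞ b p := (Bundle.contMDiffAt_totalSpace.1 hv).1
  have h := ((g.smooth (b p)).comp p hb).clm_bundle_apply₂ (E₃ := Bundle.Trivial M ℝ) hv hw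
  simp only [Bundle.contMDiffAt_totalSpace] at h
  exact h.2

lemma LorentzianMetric.oneFormSmooth_apply (g : LorentzianMetric m M)
    (hξ : VFieldSmoothOn ξ univ) : OneFormSmooth fun x => g.val x (ξ x) :=
  fun x => (g.smooth x).clm_bundle_apply (E₂ := fun x : M => TangentSpace (𝓡 m) x →L[ℝ] ℝ)
    (hξ.contMDiffAt univ_mem)

lemma VFieldSmoothOn.vfieldDiffAt (hξ : VFieldSmoothOn ξ univ) (x : M) : VFieldDiffAt ξ x :=
  (hξ.contMDiffAt (x := x) univ_mem).mdifferentiableAt (by simp)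

/-- If `ξ` is parallel, the one-form `g(ξ)` is closed: with `D ξ = 0`, metricity and the absence of
torsion, `d(g(ξ))(X, Y) = g(ξ, D_X Y - D_Y X - [X, Y]) = 0`. -/
lemma IsParallel.oneFormExtDeriv_eq_zero (h : IsParallel g ξ) (hξ : VFieldSmoothOn ξ univ)
    (x : M) (X Y : (x : M) → TangentSpace (𝓡 m) x) (hX : VFieldDiffAt X x)
    (hY : VFieldDiffAt Y x) : oneFormExtDeriv (fun x => g.val x (ξ x)) X Y x = 0 := by
  obtain ⟨D, ⟨hD, hDg⟩, hDξ⟩ := h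
  have h1 := CovariantDerivative.torsion_eq_zero_iff D |>.1 hD hX hY
  rw [oneFormExtDeriv, hDg x ξ Y (hξ.vfieldDiffAt x) hY, hDg x ξ X (hξ.vfieldDiffAt x) hX,
    hDξ, ← h1]
  simp

/-- A conformal factor `Ω` is constant along the rays: `ξ` is Killing both for `g = Ω g'` and, being
parallel, for `g'`, hence `ξ(Ω) g' = 0`. -/
lemma IsConformalFactor.mvfderiv_apply_eq_zero {Ω : M → ℝ} (h : IsConformalFactor g ξ Ω)
    (hξ : VFieldSmoothOn ξ univ) (hK : IsKilling g ξ) (x : M) :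
    mvfderiv (𝓡 m) Ω x (ξ x) = 0 := by
  obtain ⟨hΩ, -, g', hg, D, ⟨hD, hDg⟩, hDξ⟩ := h
  obtain ⟨T, hT, -⟩ := g'.lorentzian x
  have hφ := IsManifold.chart_mem_maximalAtlas (I := 𝓡 m) (n := ∞) x
  have hx := mem_chart_source (EuclideanSpace ℝ (Fin m)) x
  set φ := chartAt (EuclideanSpace ℝ (Fin m)) x
  -- a vector field `Y` with the timelike value `T` at `x`
  let Y := chartField φ (mfderiv (𝓡 m) (𝓡 m) φ x T)
  have hY : ContMDiffAt (𝓡 m) (𝓡 m).tangent ∞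
    (fun y => (⟨y, Y y⟩ : TangentBundle (𝓡 m) M)) x := contMDiffAt_chartField hφ hx _
  have hYd : VFieldDiffAt Y x := hY.mdifferentiableAt (by simp)
  have hYx : Y x = T := chartField_mfderiv hφ hx T
  have h1 := CovariantDerivative.torsion_eq_zero_iff D |>.1 hD (hξ.vfieldDiffAt x) hYd
  have h2 := hK x Y Y hYd hYd
  have h3 := hDg x Y Y hYd hYd (ξ x)
  have h4 : (fun y => g.val y (Y y) (Y y)) = fun y => Ω y * g'.val y (Y y) (Y y) := by
    funext y
    rw [hg]
    rfl
  rw [hDξ] at h1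
  simp only [zero_apply, sub_zero] at h1
  rw [h4, mvfderiv_fun_mul (hΩ.mdifferentiableAt (by simp))
    ((g'.contMDiffAt_apply hY hY).mdifferentiableAt (by simp)), hg] at h2
  simp only [add_apply, smul_apply, smul_eq_mul, h3, ← h1, hYx] at h2
  have h5 : g'.val x T T * mvfderiv (𝓡 m) Ω x (ξ x) = 0 := by linear_combination h2
  exact (mul_eq_zero.1 h5).resolve_left hT.ne

omit [IsManifold (𝓡 m) ∞ M] in
/-- A function on an integral curve segment of `ξ` is constant if near every parameter it is the
restriction of a function on `M` whose derivative along `ξ` vanishes there. The function on `M` may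
depend on the parameter. -/
lemma eq_of_isMIntegralCurveOn {γ : ℝ → M} {b : ℝ} (hb : 0 ≤ b)
    (hγ : IsMIntegralCurveOn γ ξ (Icc 0 b)) {F : ℝ → ℝ}
    (hF : ∀ t ∈ Icc 0 b, ∃ f : M → ℝ, MDifferentiableAt (𝓡 m) 𝓘(ℝ, ℝ) f (γ t) ∧
      mvfderiv (𝓡 m) f (γ t) (ξ (γ t)) = 0 ∧ ∀ᶠ t' in 𝓝[Icc 0 b] t, F t' = f (γ t')) :
    F b = F 0 := by
  have key : ∀ t ∈ Icc 0 b, HasDerivWithinAt F 0 (Icc 0 b) t := by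
    intro t ht
    obtain ⟨f, hf, hf0, hFf⟩ := hF t ht
    have h1 : HasMFDerivWithinAt 𝓘(ℝ, ℝ) 𝓘(ℝ, ℝ) (f ∘ γ) (Icc 0 b) t
        ((mfderiv (𝓡 m) 𝓘(ℝ, ℝ) f (γ t)).comp ((1 : ℝ →L[ℝ] ℝ).smulRight (ξ (γ t)))) :=
      hf.hasMFDerivAt.comp_hasMFDerivWithinAt t (hγ t ht)
    have h2 : (mfderiv (𝓡 m) 𝓘(ℝ, ℝ) f (γ t)).comp ((1 : ℝ →L[ℝ] ℝ).smulRight (ξ (γ t)))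
        = (0 : ℝ →L[ℝ] ℝ) := by
      refine ContinuousLinearMap.ext_ring ?_
      have h3 : mfderiv (𝓡 m) 𝓘(ℝ, ℝ) f (γ t) ((1 : ℝ) • ξ (γ t)) = 0 := by
        rw [one_smul]
        exact hf0
      exact h3
    have h4 : HasFDerivWithinAt (f ∘ γ) (0 : ℝ →L[ℝ] ℝ) (Icc 0 b) t :=
      HasMFDerivWithinAt.hasFDerivWithinAt (h2 ▸ h1)
    have h5 : HasDerivWithinAt (f ∘ γ) 0 (Icc 0 b) t := by
      simpa using h4.hasDerivWithinAt
    exact h5.congr_of_eventuallyEq_of_mem hFf ht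
  exact constant_of_derivWithin_zero (fun t ht => (key t ht).differentiableWithinAt)
    (fun t ht => (key t (Ico_subset_Icc_self ht)).derivWithin
      (uniqueDiffOn_Icc (lt_of_le_of_lt ht.1 ht.2) t (Ico_subset_Icc_self ht))) b ⟨hb, le_rfl⟩

end Metric

/-! ### Invariance along the rays -/

section Rays

/-- The kernel of a surjection whose target has one dimension less is a line. -/
lemma ContinuousLinearMap.exists_eq_smul_of_apply_eq_zero {n : ℕ}
    {f : EuclideanSpace ℝ (Fin (n + 1)) →L[ℝ] EuclideanSpace ℝ (Fin n)}
    (hf : Function.Surjective f) {u : EuclideanSpace ℝ (Fin (n + 1))} (hu : u ≠ 0)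
    (hfu : f u = 0) {v : EuclideanSpace ℝ (Fin (n + 1))} (hv : f v = 0) : ∃ c : ℝ, v = c • u := by
  have h1 := f.toLinearMap.finrank_range_add_finrank_ker
  rw [LinearMap.range_eq_top.2 hf, finrank_top, finrank_euclideanSpace_fin,
    finrank_euclideanSpace_fin] at h1
  have h2 : Module.finrank ℝ (LinearMap.ker f.toLinearMap) = 1 := by omega
  obtain ⟨c, hc⟩ := (finrank_eq_one_iff_of_nonzero' (⟨u, hfu⟩ : LinearMap.ker f.toLinearMap)
    (fun h => hu (congrArg Subtype.val h))).1 h2 ⟨v, hv⟩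
  exact ⟨c, (congrArg Subtype.val hc).symm⟩

variable {m n : ℕ} {M : Type*} [TopologicalSpace M] [ChartedSpace (EuclideanSpace ℝ (Fin m)) M]
  [IsManifold (𝓡 m) ∞ M] {ξ : (x : M) → TangentSpace (𝓡 m) x}

omit [IsManifold (𝓡 m) ∞ M] in
lemma IsMIntegralCurveOn.screenProj_eq {γ : ℝ → M} {b : ℝ}
    (hγ : IsMIntegralCurveOn γ ξ (Icc 0 b)) {t : ℝ} (ht : t ∈ Icc 0 b) :
    screenProj ξ (γ t) = screenProj ξ (γ 0) :=
  (Quotient.sound (Relation.EqvGen.rel _ _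
    ⟨γ, t, ht.1, hγ.mono (Icc_subset_Icc_right ht.2), rfl, rfl⟩)).symm

omit [IsManifold (𝓡 m) ∞ M] in
/-- A quantity which takes the same value at both ends of every integral curve segment only depends
on the ray. -/
lemma eq_of_screenProj_eq {α : Type*} {F : M → α}
    (hF : ∀ (γ : ℝ → M) (b : ℝ), 0 ≤ b → IsMIntegralCurveOn γ ξ (Icc 0 b) → F (γ b) = F (γ 0))
    {x y : M} (h : screenProj ξ x = screenProj ξ y) : F x = F y := by
  have h' : Relation.EqvGen _ x y := Quotient.exact h
  clear h
  induction h' with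
  | rel x y h =>
    obtain ⟨γ, b, hb, hγ, rfl, rfl⟩ := h
    exact (hF γ b hb hγ).symm
  | refl => rfl
  | symm x y h ih => exact ih.symm
  | trans x y z h h' ih ih' => exact ih.trans ih'

variable [ChartedSpace (EuclideanSpace ℝ (Fin n)) (PlatonicScreen ξ)]

lemma mfderiv_screenProj_apply_self (hξ : VFieldSmoothOn ξ univ) {x : M}
    (hd : MDifferentiableAt (𝓡 m) (𝓡 n) (screenProj ξ) x) :
    mfderiv (𝓡 m) (𝓡 n) (screenProj ξ) x (ξ x) = 0 := by
  have : IsManifold (𝓡 m) 1 M := .of_le (n := ∞) (by simp)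
  obtain ⟨γ, h0, hγ⟩ := exists_isMIntegralCurveAt_of_contMDiffAt_boundaryless (t₀ := 0)
    ((hξ.contMDiffAt (x := x) univ_mem).of_le (by simp))
  obtain ⟨ε, hε, hγ⟩ := isMIntegralCurveAt_iff'.1 hγ
  have hγ' : IsMIntegralCurveOn γ ξ (Icc 0 (ε / 2)) := hγ.mono fun t ht => by
    rw [Metric.mem_ball, Real.dist_eq, abs_lt]
    constructor <;> linarith [ht.1, ht.2]
  have hmem : (0 : ℝ) ∈ Icc 0 (ε / 2) := ⟨le_rfl, by positivity⟩
  subst h0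
  have h1 := hd.hasMFDerivAt.comp_hasMFDerivWithinAt 0 (hγ' 0 hmem)
  have h2 : HasMFDerivWithinAt 𝓘(ℝ, ℝ) (𝓡 n) (screenProj ξ ∘ γ) (Icc 0 (ε / 2)) 0 0 :=
    (hasMFDerivWithinAt_const (screenProj ξ (γ 0)) _ _).congr_of_eventuallyEq
      (eventually_mem_nhdsWithin.mono fun t ht => hγ'.screenProj_eq ht) rfl
  have h3 := ((uniqueDiffOn_Icc (by positivity : (0 : ℝ) < ε / 2)) 0 hmem).uniqueMDiffWithinAt.eq
    h1 h2
  have h4 := DFunLike.congr_fun h3 (1 : ℝ)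
  refine Eq.trans ?_ h4
  change _ = mfderiv (𝓡 m) (𝓡 n) (screenProj ξ) (γ 0) ((1 : ℝ) • ξ (γ 0))
  rw [one_smul]

end Rays

section Invariance

variable {n : ℕ} {M : Type*} [TopologicalSpace M]
  [ChartedSpace (EuclideanSpace ℝ (Fin (n + 1))) M] [IsManifold (𝓡 (n + 1)) ∞ M]
  {g : LorentzianMetric (n + 1) M} {ξ : (x : M) → TangentSpace (𝓡 (n + 1)) x}
  [ChartedSpace (EuclideanSpace ℝ (Fin n)) (PlatonicScreen ξ)]
  [IsManifold (𝓡 n) ∞ (PlatonicScreen ξ)]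

omit [IsManifold (𝓡 (n + 1)) ∞ M] [IsManifold (𝓡 n) ∞ (PlatonicScreen ξ)] in
lemma mfderiv_screenProj_mfderiv_section
    (hq : Manifold.IsSubmersion (𝓡 (n + 1)) (𝓡 n) ∞ (screenProj ξ)) {σ : PlatonicScreen ξ → M}
    {s : PlatonicScreen ξ} (hσ : ContMDiffAt (𝓡 n) (𝓡 (n + 1)) ∞ σ s)
    (h : ∀ᶠ s in 𝓝 s, screenProj ξ (σ s) = s) (v : EuclideanSpace ℝ (Fin n)) :
    mfderiv (𝓡 (n + 1)) (𝓡 n) (screenProj ξ) (σ s) (mfderiv (𝓡 n) (𝓡 (n + 1)) σ s v) = v := by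
  have hqd : MDifferentiableAt (𝓡 (n + 1)) (𝓡 n) (screenProj ξ) (σ s) :=
    hq.contMDiff.mdifferentiableAt (by simp)
  have h1 := (mfderiv_comp _ hqd (hσ.mdifferentiableAt (by simp))).symm.trans
    ((show screenProj ξ ∘ σ =ᶠ[𝓝 s] id from h).mfderiv_eq.trans mfderiv_id)
  exact DFunLike.congr_fun h1 v

omit [IsManifold (𝓡 (n + 1)) ∞ M] in
lemma mfderiv_screenProj_surjective
    (hq : Manifold.IsSubmersion (𝓡 (n + 1)) (𝓡 n) ∞ (screenProj ξ)) (x : M) :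
    Function.Surjective (mfderiv (𝓡 (n + 1)) (𝓡 n) (screenProj ξ) x) := by
  obtain ⟨σ, hσx, hσ⟩ := (hq.isSubmersionOfComplement_complement x).exists_section
  intro v
  have h : ∃ w, mfderiv (𝓡 (n + 1)) (𝓡 n) (screenProj ξ) (σ (screenProj ξ x)) w
      = (v : EuclideanSpace ℝ (Fin n)) :=
    ⟨_, mfderiv_screenProj_mfderiv_section hq hσ.self_of_nhds.1 (hσ.mono fun _ h => h.2) v⟩
  rw [hσx] at h
  exact h

lemma exists_eq_smul_of_mfderiv_screenProj_eq_zero (hg : IsPlatonicWave g ξ)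
    (hq : Manifold.IsSubmersion (𝓡 (n + 1)) (𝓡 n) ∞ (screenProj ξ)) {x : M}
    {v : TangentSpace (𝓡 (n + 1)) x}
    (hv : mfderiv (𝓡 (n + 1)) (𝓡 n) (screenProj ξ) x v = 0) : ∃ c : ℝ, v = c • ξ x := by
  exact ContinuousLinearMap.exists_eq_smul_of_apply_eq_zero (n := n)
    (f := mfderiv (𝓡 (n + 1)) (𝓡 n) (screenProj ξ) x)
    (mfderiv_screenProj_surjective hq x) (hg.ne_zero x)
    (mfderiv_screenProj_apply_self hg.smooth (hq.contMDiff.mdifferentiableAt (by simp))) hv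

/-- At a fixed point, `g(ξ, v)` and, on vectors orthogonal to `ξ`, `g(v, w)` only depend on the
projection of `v` to the screen. -/
lemma val_congr_of_mfderiv_screenProj_eq (hg : IsPlatonicWave g ξ)
    (hq : Manifold.IsSubmersion (𝓡 (n + 1)) (𝓡 n) ∞ (screenProj ξ)) {x : M}
    {v v' : TangentSpace (𝓡 (n + 1)) x}
    (hv : mfderiv (𝓡 (n + 1)) (𝓡 n) (screenProj ξ) x v
      = mfderiv (𝓡 (n + 1)) (𝓡 n) (screenProj ξ) x v') :
    g.val x (ξ x) v = g.val x (ξ x) v' ∧ ∀ w, g.val x (ξ x) w = 0 → g.val x v w = g.val x v' w := by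
  obtain ⟨c, hc⟩ := exists_eq_smul_of_mfderiv_screenProj_eq_zero hg hq (v := v - v')
    (by rw [map_sub, hv, sub_self])
  rw [sub_eq_iff_eq_add] at hc
  subst hc
  -- the difference `c • ξ` is null and orthogonal to everything orthogonal to `ξ`
  refine ⟨by simp [hg.null x], fun w hw => by simp [hw]⟩

omit [ChartedSpace (EuclideanSpace ℝ (Fin n)) (PlatonicScreen ξ)]
  [IsManifold (𝓡 n) ∞ (PlatonicScreen ξ)] in
lemma IsConformalFactor.eq_of_screenProj_eq {Ω : M → ℝ} (hΩ : IsConformalFactor g ξ Ω)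
    (hg : IsPlatonicWave g ξ) {x y : M} (h : screenProj ξ x = screenProj ξ y) : Ω x = Ω y :=
  _root_.eq_of_screenProj_eq (fun γ b hb hγ => eq_of_isMIntegralCurveOn hb hγ (F := Ω ∘ γ)
    fun t _ => ⟨Ω, hΩ.1.mdifferentiableAt (by simp),
      hΩ.mvfderiv_apply_eq_zero hg.smooth hg.killing _, .of_forall fun _ => rfl⟩) h

/-- `g(ξ, v)` only depends on the ray and on the projection of `v` to the screen. Along the ray `v` is
extended to a field `Y` with constant projection, and the Killing equation gives
`ξ(g(ξ, Y)) = g(ξ, [ξ, Y]) = 0`, because `[ξ, Y]` is a multiple of the null vector `ξ`. -/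
lemma val_field_eq_of_screenProj_eq (hg : IsPlatonicWave g ξ)
    (hq : Manifold.IsSubmersion (𝓡 (n + 1)) (𝓡 n) ∞ (screenProj ξ)) {x x' : M}
    (h : screenProj ξ x = screenProj ξ x') {v : TangentSpace (𝓡 (n + 1)) x}
    {v' : TangentSpace (𝓡 (n + 1)) x'} {u : EuclideanSpace ℝ (Fin n)}
    (hv : mfderiv (𝓡 (n + 1)) (𝓡 n) (screenProj ξ) x v = u)
    (hv' : mfderiv (𝓡 (n + 1)) (𝓡 n) (screenProj ξ) x' v' = u) :
    g.val x (ξ x) v = g.val x' (ξ x') v' := by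
  choose L hL using fun x => mfderiv_screenProj_surjective hq x u
  have hξq (y : M) : mfderiv (𝓡 (n + 1)) (𝓡 n) (screenProj ξ) y (ξ y) = 0 :=
    mfderiv_screenProj_apply_self hg.smooth (hq.contMDiff.mdifferentiableAt (by simp))
  rw [(val_congr_of_mfderiv_screenProj_eq hg hq (hv.trans (hL x).symm)).1,
    (val_congr_of_mfderiv_screenProj_eq hg hq (hv'.trans (hL x').symm)).1]
  refine eq_of_screenProj_eq (F := fun x => g.val x (ξ x) (L x)) (fun γ b hb hγ => ?_) h
  refine eq_of_isMIntegralCurveOn hb hγ (F := fun t => g.val (γ t) (ξ (γ t)) (L (γ t)))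
    fun t ht => ?_
  have hξ := hg.smooth.vfieldDiffAt (γ t)
  obtain ⟨Y, hY, hYu, hYξ⟩ := (hq.isSubmersionOfComplement_complement (γ t)).exists_lift hξ hξq u
  refine ⟨fun y => g.val y (ξ y) (Y y),
    (g.contMDiffAt_apply (hg.smooth.contMDiffAt univ_mem) hY).mdifferentiableAt (by simp), ?_, ?_⟩
  · obtain ⟨c, hc⟩ := exists_eq_smul_of_mfderiv_screenProj_eq_zero hg hq hYξ
    have h1 := hg.killing (γ t) ξ Y hξ (hY.mdifferentiableAt (by simp))
    rw [hc] at h1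
    simpa [mlieBracket_self, hg.null] using h1
  · filter_upwards [(hγ t ht).continuousWithinAt.eventually hYu, self_mem_nhdsWithin] with t' h1 h2
    exact (val_congr_of_mfderiv_screenProj_eq hg hq ((hL _).trans
      (h1 ((hγ.screenProj_eq h2).trans (hγ.screenProj_eq ht).symm)).symm)).1

/-- The scalar product of vectors orthogonal to `ξ` only depends on the ray and on their projections
to the screen: `ξ(g(Y, Z)) = g([ξ, Y], Z) + g(Y, [ξ, Z])`, where both brackets are multiples of `ξ`,
which is orthogonal to `Y` and `Z`. -/
lemma val_eq_of_screenProj_eq (hg : IsPlatonicWave g ξ)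
    (hq : Manifold.IsSubmersion (𝓡 (n + 1)) (𝓡 n) ∞ (screenProj ξ)) {x x' : M}
    (h : screenProj ξ x = screenProj ξ x') {v w : TangentSpace (𝓡 (n + 1)) x}
    {v' w' : TangentSpace (𝓡 (n + 1)) x'} {a b : EuclideanSpace ℝ (Fin n)}
    (hv : mfderiv (𝓡 (n + 1)) (𝓡 n) (screenProj ξ) x v = a)
    (hv' : mfderiv (𝓡 (n + 1)) (𝓡 n) (screenProj ξ) x' v' = a)
    (hw : mfderiv (𝓡 (n + 1)) (𝓡 n) (screenProj ξ) x w = b)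
    (hw' : mfderiv (𝓡 (n + 1)) (𝓡 n) (screenProj ξ) x' w' = b)
    (hv0 : g.val x (ξ x) v = 0) (hw0 : g.val x (ξ x) w = 0) :
    g.val x v w = g.val x' v' w' := by
  choose L hL using fun x a => mfderiv_screenProj_surjective hq x a
  have hξq (y : M) : mfderiv (𝓡 (n + 1)) (𝓡 n) (screenProj ξ) y (ξ y) = 0 :=
    mfderiv_screenProj_apply_self hg.smooth (hq.contMDiff.mdifferentiableAt (by simp))
  have hC (a : EuclideanSpace ℝ (Fin n)) {x x' : M} (h : screenProj ξ x = screenProj ξ x')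
      {v : TangentSpace (𝓡 (n + 1)) x} {v' : TangentSpace (𝓡 (n + 1)) x'}
      (hv : mfderiv (𝓡 (n + 1)) (𝓡 n) (screenProj ξ) x v = a)
      (hv' : mfderiv (𝓡 (n + 1)) (𝓡 n) (screenProj ξ) x' v' = a)
      (hv0 : g.val x (ξ x) v = 0) : g.val x' (ξ x') v' = 0 :=
    (val_field_eq_of_screenProj_eq hg hq h hv hv').symm.trans hv0
  have hR {x : M} {v w v' w' : TangentSpace (𝓡 (n + 1)) x}
      (hv : mfderiv (𝓡 (n + 1)) (𝓡 n) (screenProj ξ) x v = a)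
      (hv' : mfderiv (𝓡 (n + 1)) (𝓡 n) (screenProj ξ) x v' = a)
      (hw : mfderiv (𝓡 (n + 1)) (𝓡 n) (screenProj ξ) x w = b)
      (hw' : mfderiv (𝓡 (n + 1)) (𝓡 n) (screenProj ξ) x w' = b)
      (hv0 : g.val x (ξ x) v = 0) (hw0 : g.val x (ξ x) w = 0) :
      g.val x v w = g.val x v' w' := by
    rw [(val_congr_of_mfderiv_screenProj_eq hg hq (hv.trans hv'.symm)).2 w hw0, g.symm x v',
      (val_congr_of_mfderiv_screenProj_eq hg hq (hw.trans hw'.symm)).2 v'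
        (hC a rfl hv hv' hv0), g.symm]
  rw [hR hv (hL x a) hw (hL x b) hv0 hw0,
    hR hv' (hL x' a) hw' (hL x' b) (hC a h hv hv' hv0) (hC b h hw hw' hw0)]
  -- by `hC` the orthogonality conditions are constant along rays, so that `F` is well behaved
  classical
  let F : M → ℝ := fun x => if g.val x (ξ x) (L x a) = 0 ∧ g.val x (ξ x) (L x b) = 0 then
    g.val x (L x a) (L x b) else 0
  suffices hF : F x = F x' by
    rwa [show F x = _ from if_pos ⟨hC a rfl hv (hL x a) hv0, hC b rfl hw (hL x b) hw0⟩,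
      show F x' = _ from if_pos ⟨hC a h hv (hL x' a) hv0, hC b h hw (hL x' b) hw0⟩] at hF
  refine eq_of_screenProj_eq (fun γ c hc hγ => ?_) h
  have hq0 := hγ.screenProj_eq (right_mem_Icc.2 hc)
  by_cases h0 : g.val (γ 0) (ξ (γ 0)) (L (γ 0) a) = 0 ∧ g.val (γ 0) (ξ (γ 0)) (L (γ 0) b) = 0
  swap
  · rw [show F (γ 0) = _ from if_neg h0]
    exact if_neg fun h1 => h0 ⟨hC a hq0 (hL _ a) (hL _ a) h1.1, hC b hq0 (hL _ b) (hL _ b) h1.2⟩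
  have h0' (t : ℝ) (ht : t ∈ Icc 0 c) :
      g.val (γ t) (ξ (γ t)) (L (γ t) a) = 0 ∧ g.val (γ t) (ξ (γ t)) (L (γ t) b) = 0 :=
    ⟨hC a (hγ.screenProj_eq ht).symm (hL _ a) (hL _ a) h0.1,
      hC b (hγ.screenProj_eq ht).symm (hL _ b) (hL _ b) h0.2⟩
  refine eq_of_isMIntegralCurveOn hc hγ (F := F ∘ γ) fun t ht => ?_
  have hξ := hg.smooth.vfieldDiffAt (γ t)
  have hsub := hq.isSubmersionOfComplement_complement (γ t)
  obtain ⟨Y, hY, hYa, hYξ⟩ := hsub.exists_lift hξ hξq a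
  obtain ⟨Z, hZ, hZb, hZξ⟩ := hsub.exists_lift hξ hξq b
  refine ⟨fun y => g.val y (Y y) (Z y),
    (g.contMDiffAt_apply hY hZ).mdifferentiableAt (by simp), ?_, ?_⟩
  · obtain ⟨r, hr⟩ := exists_eq_smul_of_mfderiv_screenProj_eq_zero hg hq hYξ
    obtain ⟨s, hs⟩ := exists_eq_smul_of_mfderiv_screenProj_eq_zero hg hq hZξ
    have h1 := hg.killing (γ t) Y Z (hY.mdifferentiableAt (by simp))
      (hZ.mdifferentiableAt (by simp))
    have h2 := hC a rfl (hL (γ t) a) (hYa.self_of_nhds rfl) (h0' t ht).1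
    have h3 := hC b rfl (hL (γ t) b) (hZb.self_of_nhds rfl) (h0' t ht).2
    rw [hr, hs] at h1
    simpa [h3, g.symm (γ t) (Y (γ t)), h2] using h1
  · filter_upwards [(hγ t ht).continuousWithinAt.eventually hYa,
      (hγ t ht).continuousWithinAt.eventually hZb, self_mem_nhdsWithin] with t' h1 h2 h3
    have h4 := (hγ.screenProj_eq h3).trans (hγ.screenProj_eq ht).symm
    refine Eq.trans (if_pos (h0' t' h3)) ?_
    exact hR (hL _ a) (h1 h4) (hL _ b) (h2 h4) (h0' t' h3).1 (h0' t' h3).2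

end Invariance

/-! ### Aristotelian structures from transverse maps -/

section Pullback

variable {m n : ℕ} {M : Type*} [TopologicalSpace M] [ChartedSpace (EuclideanSpace ℝ (Fin m)) M]
  [IsManifold (𝓡 m) ∞ M] {N : Type*} [TopologicalSpace N]
  [ChartedSpace (EuclideanSpace ℝ (Fin n)) N] [IsManifold (𝓡 n) ∞ N]

lemma contMDiffAt_oneForm_of_apply {ψ : (x : M) → TangentSpace (𝓡 m) x →L[ℝ] ℝ} {x : M}
    (h : ∀ X : (x : M) → TangentSpace (𝓡 m) x,
      ContMDiffAt (𝓡 m) (𝓡 m).tangent ∞ (fun y => (⟨y, X y⟩ : TangentBundle (𝓡 m) M)) x →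
        ContMDiffAt (𝓡 m) 𝓘(ℝ, ℝ) ∞ (fun y => ψ y (X y)) x) :
    ContMDiffAt (𝓡 m) ((𝓡 m).prod 𝓘(ℝ, EuclideanSpace ℝ (Fin m) →L[ℝ] ℝ)) ∞
      (fun x => Bundle.TotalSpace.mk' (EuclideanSpace ℝ (Fin m) →L[ℝ] ℝ)
        (E := fun x : M => TangentSpace (𝓡 m) x →L[ℝ] ℝ) x (ψ x)) x := by
  let e := trivializationAt (EuclideanSpace ℝ (Fin m)) (TangentSpace (𝓡 m) : M → Type _) x
  have hx : x ∈ e.baseSet := FiberBundle.mem_baseSet_trivializationAt' x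
  have hX (a : EuclideanSpace ℝ (Fin m)) : ContMDiffAt (𝓡 m) (𝓡 m).tangent ∞
      (fun y => (⟨y, e.symmL ℝ y a⟩ : TangentBundle (𝓡 m) M)) x := by
    refine Bundle.contMDiffAt_totalSpace.2 ⟨contMDiffAt_id, ?_⟩
    refine (contMDiffAt_const (c := a)).congr_of_eventuallyEq ?_
    filter_upwards [e.open_baseSet.mem_nhds hx] with y hy
    refine Eq.trans ?_ (congrArg Prod.snd (e.apply_mk_symm hy a))
    rw [← e.symmL_apply (R := ℝ) hy]
  refine (contMDiffAt_hom_bundle (E₂ := Bundle.Trivial M ℝ) _).2 ⟨contMDiffAt_id, ?_⟩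
  -- a linear form on `EuclideanSpace` is a linear function of its values on the basis
  let L : (Fin m → ℝ) →L[ℝ] EuclideanSpace ℝ (Fin m) →L[ℝ] ℝ :=
    ∑ i, (ContinuousLinearMap.proj i).smulRight (EuclideanSpace.proj i)
  have hL (f : EuclideanSpace ℝ (Fin m) →L[ℝ] ℝ) :
      L (fun i => f (EuclideanSpace.single i 1)) = f := by
    ext v
    conv_rhs => rw [← (EuclideanSpace.basisFun (Fin m) ℝ).sum_repr v, map_sum]
    simp [L, mul_comm]
  have h1 : ContMDiffAt (𝓡 m) 𝓘(ℝ, Fin m → ℝ) ∞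
      (fun y i => ψ y (e.symmL ℝ y (EuclideanSpace.single i 1))) x :=
    contMDiffAt_pi_space.2 fun i => h _ (hX _)
  refine (L.contDiff.contMDiff.contMDiffAt.comp x h1).congr_of_eventuallyEq (.of_forall fun y => ?_)
  refine (hL _).symm.trans (congrArg L (funext fun i => ?_))
  simp [ContinuousLinearMap.inCoordinates, e]

/-- The push-forward of a smooth vector field by a smooth map is a smooth field along the map. -/
lemma contMDiffAt_mfderiv_apply {f : N → M} {p : N} (hf : ContMDiffAt (𝓡 n) (𝓡 m) ∞ f p)
    {X : (x : N) → TangentSpace (𝓡 n) x} (hX : ContMDiffAt (𝓡 n) (𝓡 n).tangent ∞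
      (fun y => (⟨y, X y⟩ : TangentBundle (𝓡 n) N)) p) :
    ContMDiffAt (𝓡 n) (𝓡 m).tangent ∞
      (fun y => (⟨f y, mfderiv (𝓡 n) (𝓡 m) f y (X y)⟩ : TangentBundle (𝓡 m) M)) p :=
  ContMDiffAt.clm_apply_of_inCoordinates (hf.mfderiv_const (m := ∞) (by simp)) hX hf

variable {g : LorentzianMetric m M} {ξ : (x : M) → TangentSpace (𝓡 m) x}

omit [IsManifold (𝓡 n) ∞ N] in
/-- The pullback of `g(ξ)` by `f` is locally `Ω dt`: with `g = Ω g'`, the form `g'(ξ)` is closed, hence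
locally some `dτ`, and `t = τ ∘ f`. -/
lemma IsConformalFactor.exists_eq_mul_mvfderiv {Ω : M → ℝ} (hΩ : IsConformalFactor g ξ Ω)
    (hξ : VFieldSmoothOn ξ univ) {f : N → M} {p : N}
    (hf : ∀ᶠ s in 𝓝 p, ContMDiffAt (𝓡 n) (𝓡 m) ∞ f s) :
    ∃ t : N → ℝ, ∀ᶠ s in 𝓝 p, ContMDiffAt (𝓡 n) 𝓘(ℝ, ℝ) ∞ t s ∧ ∀ v : TangentSpace (𝓡 n) s,
      g.val (f s) (ξ (f s)) (mfderiv (𝓡 n) (𝓡 m) f s v) = Ω (f s) * mvfderiv (𝓡 n) t s v := by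
  obtain ⟨-, -, g', hg, hpar⟩ := hΩ
  obtain ⟨U, τ, hU, hpU, hτ, hτU⟩ := exists_eq_mvfderiv_of_closed (g'.oneFormSmooth_apply hξ)
    (fun x X Y => hpar.oneFormExtDeriv_eq_zero hξ x X Y) (f p)
  refine ⟨τ ∘ f, ?_⟩
  filter_upwards [hf, hf.self_of_nhds.continuousAt.eventually_mem (hU.mem_nhds hpU)] with s h1 h2
  have h3 := hτ.contMDiffAt (hU.mem_nhds h2)
  refine ⟨h3.comp s h1, fun v => ?_⟩
  rw [hg]
  have h4 := mfderiv_comp s (h3.mdifferentiableAt (by simp)) (h1.mdifferentiableAt (by simp))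
  refine congrArg (Ω (f s) * ·) ((DFunLike.congr_fun (hτU _ h2) _).trans ?_)
  exact (DFunLike.congr_fun h4 v).symm

end Pullback

section Structures

variable {n : ℕ} {M : Type*} [TopologicalSpace M] [ChartedSpace (EuclideanSpace ℝ (Fin (n + 1))) M]
  [IsManifold (𝓡 (n + 1)) ∞ M] {N : Type*} [TopologicalSpace N]
  [ChartedSpace (EuclideanSpace ℝ (Fin n)) N] [IsManifold (𝓡 n) ∞ N]
  {g : LorentzianMetric (n + 1) M} {ξ : (x : M) → TangentSpace (𝓡 (n + 1)) x}

lemma ContinuousLinearMap.exists_eq_add_smul_of_transverse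
    {f : EuclideanSpace ℝ (Fin n) →L[ℝ] EuclideanSpace ℝ (Fin (n + 1))}
    {u : EuclideanSpace ℝ (Fin (n + 1))} (hu : u ≠ 0) (h : ∀ v (c : ℝ), f v = c • u → v = 0)
    (w : EuclideanSpace ℝ (Fin (n + 1))) : ∃ v, ∃ c : ℝ, w = f v + c • u := by
  let F : EuclideanSpace ℝ (Fin n) × ℝ →ₗ[ℝ] EuclideanSpace ℝ (Fin (n + 1)) :=
    f.toLinearMap.coprod (LinearMap.toSpanSingleton ℝ _ u)
  have hF (v : EuclideanSpace ℝ (Fin n)) (c : ℝ) : F (v, c) = f v + c • u := by simp [F]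
  have hinj : Function.Injective F := by
    refine (injective_iff_map_eq_zero F).2 fun ⟨v, c⟩ h0 => ?_
    rw [hF] at h0
    have hv : v = 0 := h v (-c) (by rw [neg_smul]; exact eq_neg_of_add_eq_zero_left h0)
    subst hv
    rw [map_zero, zero_add, smul_eq_zero] at h0
    rw [h0.resolve_right hu]
    rfl
  obtain ⟨⟨v, c⟩, hvc⟩ := (LinearMap.injective_iff_surjective_of_finrank_eq_finrank
    (by simp)).1 hinj w
  exact ⟨v, c, by rw [← hF, hvc]⟩

/-- The differential of `f` at `p` is injective and its range does not contain `ξ`. (Injectivity is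
the case `c = 0`.) -/
def IsTransverseAt (ξ : (x : M) → TangentSpace (𝓡 (n + 1)) x) (f : N → M) (p : N) : Prop :=
  ∀ (v : TangentSpace (𝓡 n) p) (c : ℝ),
    mfderiv (𝓡 n) (𝓡 (n + 1)) f p v = c • ξ (f p) → v = 0

/-- The Aristotelian structure obtained by lifting tangent vectors of `N` to `M` by linear maps `L`,
and measuring the lifts with `g`. The lifts need not be smooth, but near every point the clock and
the rulers have to be those obtained from a smooth map `f : N → M` transverse to `ξ`. -/
noncomputable def AristotelianStructure.ofLift (hg : IsPlatonicWave g ξ) (b : N → M)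
    (L : (p : N) → TangentSpace (𝓡 n) p →L[ℝ] TangentSpace (𝓡 (n + 1)) (b p))
    (h : ∀ p, ∃ f : N → M, IsTransverseAt ξ f p ∧ ∀ᶠ s in 𝓝 p,
      ContMDiffAt (𝓡 n) (𝓡 (n + 1)) ∞ f s ∧
      (∀ v : TangentSpace (𝓡 n) s, g.val (b s) (ξ (b s)) (L s v)
        = g.val (f s) (ξ (f s)) (mfderiv (𝓡 n) (𝓡 (n + 1)) f s v)) ∧
      ∀ v w : TangentSpace (𝓡 n) s, g.val (b s) (ξ (b s)) (L s v) = 0 →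
        g.val (b s) (ξ (b s)) (L s w) = 0 → g.val (b s) (L s v) (L s w)
          = g.val (f s) (mfderiv (𝓡 n) (𝓡 (n + 1)) f s v) (mfderiv (𝓡 n) (𝓡 (n + 1)) f s w)) :
    AristotelianStructure n N where
  clock p := (g.val (b p) (ξ (b p))).comp (L p)
  clock_smooth p := by
    obtain ⟨f, -, hf⟩ := h p
    refine contMDiffAt_oneForm_of_apply fun X hX => ?_
    refine (g.contMDiffAt_apply ((hg.smooth.contMDiffAt univ_mem).comp p hf.self_of_nhds.1)
      (contMDiffAt_mfderiv_apply hf.self_of_nhds.1 hX)).congr_of_eventuallyEq ?_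
    exact hf.mono fun s hs => hs.2.1 (X s)
  clock_ne_zero p h0 := by
    obtain ⟨f, hft, hf⟩ := h p
    obtain ⟨w, hw⟩ := g.exists_ne_zero_of_null (hg.ne_zero (f p)) (hg.null (f p))
    obtain ⟨v, c, rfl⟩ := ContinuousLinearMap.exists_eq_add_smul_of_transverse (n := n)
      (f := mfderiv (𝓡 n) (𝓡 (n + 1)) f p) (hg.ne_zero (f p)) hft w
    refine hw ?_
    have h1 : g.val (f p) (ξ (f p)) (mfderiv (𝓡 n) (𝓡 (n + 1)) f p v) = 0 :=
      (hf.self_of_nhds.2.1 v).symm.trans (DFunLike.congr_fun h0 v)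
    have h2 : g.val (f p) (ξ (f p)) (c • ξ (f p)) = 0 := by rw [map_smul, hg.null, smul_zero]
    exact (map_add (g.val (f p) (ξ (f p))) _ _).trans
      ((congrArg₂ (· + ·) h1 h2).trans (add_zero 0))
  clock_integrable := by
    refine frobeniusIntegrable_of_locally_smul_mvfderiv fun p => ?_
    obtain ⟨f, -, hf⟩ := h p
    obtain ⟨Ω, hΩ⟩ := hg.conformal
    obtain ⟨t, ht⟩ := hΩ.exists_eq_mul_mvfderiv hg.smooth (hf.mono fun s hs => hs.1)
    refine ⟨Ω ∘ f, t, hΩ.1.contMDiffAt.comp p hf.self_of_nhds.1, ht.self_of_nhds.1, ?_⟩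
    filter_upwards [hf, ht] with s h1 h2
    exact ContinuousLinearMap.ext fun v => (h1.2.1 v).trans (h2.2 v)
  rulers p := LinearMap.mk₂ ℝ (fun v w => g.val (b p) (L p v) (L p w))
    (fun v v' w => DFunLike.congr_fun (map_add ((g.val (b p)).comp (L p)) v.1 v'.1) (L p w))
    (fun c v w => DFunLike.congr_fun (map_smul ((g.val (b p)).comp (L p)) c v.1) (L p w))
    (fun v w w' => map_add ((g.val (b p) (L p v)).comp (L p)) w.1 w'.1)
    (fun c v w => map_smul ((g.val (b p) (L p v)).comp (L p)) c w.1)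
  rulers_symm p v w := g.symm _ _ _
  rulers_pos p v hv := by
    obtain ⟨f, hft, hf⟩ := h p
    obtain ⟨-, h1, h2⟩ := hf.self_of_nhds
    refine lt_of_lt_of_eq ?_ (h2 v v v.2 v.2).symm
    exact g.pos_of_orthogonal_null (hg.ne_zero _) (hg.null _) ((h1 v).symm.trans v.2)
      fun c hc => hv (Subtype.ext (hft v c hc))
  rulers_smooth U hU X Y hX hY p hp := by
    obtain ⟨f, -, hf⟩ := h p
    refine ContMDiffAt.contMDiffWithinAt ?_
    refine (g.contMDiffAt_apply
      (contMDiffAt_mfderiv_apply hf.self_of_nhds.1 (hX.contMDiffAt (hU.mem_nhds hp)))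
      (contMDiffAt_mfderiv_apply hf.self_of_nhds.1
        (hY.contMDiffAt (hU.mem_nhds hp)))).congr_of_eventuallyEq ?_
    exact hf.mono fun s hs => hs.2.2 _ _ (X s).2 (Y s).2

end Structures

/-! ### The Platonic screen and the screen worldvolumes -/

section Screen

variable {n : ℕ} {M : Type*} [TopologicalSpace M] [ChartedSpace (EuclideanSpace ℝ (Fin (n + 1))) M]
  [IsManifold (𝓡 (n + 1)) ∞ M]
  {g : LorentzianMetric (n + 1) M} {ξ : (x : M) → TangentSpace (𝓡 (n + 1)) x}
  [ChartedSpace (EuclideanSpace ℝ (Fin n)) (PlatonicScreen ξ)]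
  [IsManifold (𝓡 n) ∞ (PlatonicScreen ξ)]

lemma ContinuousLinearMap.exists_rightInverse_of_surjective_euclideanSpace {m : ℕ}
    {f : EuclideanSpace ℝ (Fin m) →L[ℝ] EuclideanSpace ℝ (Fin n)} (hf : Function.Surjective f) :
    ∃ L : EuclideanSpace ℝ (Fin n) →L[ℝ] EuclideanSpace ℝ (Fin m), ∀ v, f (L v) = v := by
  obtain ⟨L, hL⟩ := f.toLinearMap.exists_rightInverse_of_surjective (LinearMap.range_eq_top.2 hf)
  exact ⟨L.toContinuousLinearMap, fun v => DFunLike.congr_fun hL v⟩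

omit [IsManifold (𝓡 (n + 1)) ∞ M] in
lemma exists_section_screenProj
    (hq : Manifold.IsSubmersion (𝓡 (n + 1)) (𝓡 n) ∞ (screenProj ξ)) (s : PlatonicScreen ξ) :
    ∃ σ : PlatonicScreen ξ → M, ∀ᶠ y in 𝓝 s,
      ContMDiffAt (𝓡 n) (𝓡 (n + 1)) ∞ σ y ∧ ∀ᶠ z in 𝓝 y, screenProj ξ (σ z) = z := by
  obtain ⟨x, rfl⟩ := Quotient.exists_rep s
  obtain ⟨σ, -, hσ⟩ := (hq.isSubmersionOfComplement_complement x).exists_section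
  exact ⟨σ, hσ.eventually_nhds.mono fun y hy => ⟨hy.self_of_nhds.1, hy.mono fun z hz => hz.2⟩⟩

/-- The Aristotelian structure of the Platonic screen: tangent vectors are lifted linearly to
arbitrarily chosen representatives in `M`. By the invariance along the rays, this agrees near every
point with what a smooth local section of the projection gives. -/
lemma exists_isInducedOnQuotient (hg : IsPlatonicWave g ξ)
    (hq : Manifold.IsSubmersion (𝓡 (n + 1)) (𝓡 n) ∞ (screenProj ξ)) :
    ∃ A : AristotelianStructure n (PlatonicScreen ξ),
      A.IsInducedOnQuotient g ξ (screenProj ξ) := by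
  obtain ⟨b, hb⟩ : ∃ b : PlatonicScreen ξ → M, ∀ s, screenProj ξ (b s) = s :=
    ⟨Quotient.out, Quotient.out_eq⟩
  have hex (s : PlatonicScreen ξ) :
      ∃ L : TangentSpace (𝓡 n) s →L[ℝ] TangentSpace (𝓡 (n + 1)) (b s),
        ∀ v : EuclideanSpace ℝ (Fin n),
          mfderiv (𝓡 (n + 1)) (𝓡 n) (screenProj ξ) (b s) (L v) = v :=
    ContinuousLinearMap.exists_rightInverse_of_surjective_euclideanSpace
      (mfderiv_screenProj_surjective hq (b s))
  choose L hL using hex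
  refine ⟨.ofLift hg b L fun s => ?_, ?_, ?_⟩
  · obtain ⟨σ, hσ⟩ := exists_section_screenProj hq s
    refine ⟨σ, fun v c hc => ?_, ?_⟩
    · have h1 := mfderiv_screenProj_mfderiv_section hq hσ.self_of_nhds.1 hσ.self_of_nhds.2 v
      have h2 : mfderiv (𝓡 (n + 1)) (𝓡 n) (screenProj ξ) (σ s) (c • ξ (σ s)) = 0 := by
        rw [map_smul, mfderiv_screenProj_apply_self hg.smooth
          (hq.contMDiff.mdifferentiableAt (by simp)), smul_zero]
      exact h1.symm.trans ((congrArg _ hc).trans h2)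
    · filter_upwards [hσ] with y hy
      have h1 := mfderiv_screenProj_mfderiv_section hq hy.1 hy.2
      have h2 := (hb y).trans hy.2.self_of_nhds.symm
      exact ⟨hy.1, fun v => val_field_eq_of_screenProj_eq hg hq h2 (hL y v) (h1 v),
        fun v w hv hw => val_eq_of_screenProj_eq hg hq h2 (hL y v) (h1 v) (hL y w) (h1 w) hv hw⟩
  · exact fun x v => val_field_eq_of_screenProj_eq hg hq (hb _) (hL _ _) rfl
  · intro x v w v' w' hv hw
    exact val_eq_of_screenProj_eq hg hq (hb _) (hL _ v'.1) hv (hL _ w'.1) hw v'.2 w'.2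

lemma AristotelianStructure.eq_of_isInducedOnQuotient
    {A A' : AristotelianStructure n (PlatonicScreen ξ)}
    (hq : Manifold.IsSubmersion (𝓡 (n + 1)) (𝓡 n) ∞ (screenProj ξ))
    (hA : A.IsInducedOnQuotient g ξ (screenProj ξ))
    (hA' : A'.IsInducedOnQuotient g ξ (screenProj ξ)) : A' = A := by
  have hsurj (s : PlatonicScreen ξ) : ∃ x, screenProj ξ x = s := Quotient.exists_rep s
  have hclock : A'.clock = A.clock := by
    funext s
    obtain ⟨x, rfl⟩ := hsurj s
    refine ContinuousLinearMap.ext fun u => ?_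
    obtain ⟨v, rfl⟩ := mfderiv_screenProj_surjective hq x u
    exact (hA'.1 x v).trans (hA.1 x v).symm
  obtain ⟨c, hc, hc0, hci, r, hr, hr', hr''⟩ := A
  obtain ⟨c', hc', hc0', hci', r', hrr, hrr', hrr''⟩ := A'
  obtain rfl : c' = c := hclock
  obtain rfl : r' = r := by
    funext s
    obtain ⟨x, rfl⟩ := hsurj s
    refine LinearMap.ext₂ fun u u' => ?_
    obtain ⟨v, hv⟩ := mfderiv_screenProj_surjective hq x u.1
    obtain ⟨v', hv'⟩ := mfderiv_screenProj_surjective hq x u'.1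
    exact (hA'.2 x v v' u u' hv hv').trans (hA.2 x v v' u u' hv hv').symm
  rfl

/-- A conformal factor descends to the screen, and composing a local section of the projection with
a local primitive of `g'(ξ)` gives an absolute time. -/
lemma IsConformalFactor.exists_screen (hg : IsPlatonicWave g ξ)
    (hq : Manifold.IsSubmersion (𝓡 (n + 1)) (𝓡 n) ∞ (screenProj ξ))
    {A : AristotelianStructure n (PlatonicScreen ξ)}
    (hA : A.IsInducedOnQuotient g ξ (screenProj ξ)) {Ω : M → ℝ} (hΩ : IsConformalFactor g ξ Ω) :
    ∃ Ω' : PlatonicScreen ξ → ℝ, ContMDiff (𝓡 n) 𝓘(ℝ, ℝ) ∞ Ω' ∧ (∀ s, 0 < Ω' s) ∧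
      (∀ x, Ω' (screenProj ξ x) = Ω x) ∧
      ∀ s, ∃ (U : Set (PlatonicScreen ξ)) (t : PlatonicScreen ξ → ℝ), IsOpen U ∧ s ∈ U ∧
        ContMDiffOn (𝓡 n) 𝓘(ℝ, ℝ) ∞ t U ∧
        ∀ y ∈ U, A.clock y = Ω' y • mvfderiv (𝓡 n) t y := by
  obtain ⟨b, hb⟩ : ∃ b : PlatonicScreen ξ → M, ∀ s, screenProj ξ (b s) = s :=
    ⟨Quotient.out, Quotient.out_eq⟩
  have hΩ' (x : M) : Ω (b (screenProj ξ x)) = Ω x := hΩ.eq_of_screenProj_eq hg (hb _)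
  refine ⟨Ω ∘ b, fun s => ?_, fun s => hΩ.2.1 _, hΩ', fun s => ?_⟩
  · obtain ⟨σ, hσ⟩ := exists_section_screenProj hq s
    refine (hΩ.1.contMDiffAt.comp s hσ.self_of_nhds.1).congr_of_eventuallyEq ?_
    filter_upwards [hσ.self_of_nhds.2] with y hy
    rw [Function.comp_apply, Function.comp_apply, ← hΩ' (σ y), hy]
  · obtain ⟨σ, hσ⟩ := exists_section_screenProj hq s
    obtain ⟨t, ht⟩ := hΩ.exists_eq_mul_mvfderiv hg.smooth (hσ.mono fun y hy => hy.1)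
    obtain ⟨U, hU, hUo, hsU⟩ := eventually_nhds_iff.1 (hσ.and ht)
    refine ⟨U, t, hUo, hsU, fun y hy => (hU y hy).2.1.contMDiffWithinAt, fun y hy => ?_⟩
    obtain ⟨⟨h1, h2⟩, -, h3⟩ := hU y hy
    have h4 := h2.self_of_nhds
    refine ContinuousLinearMap.ext fun v => ?_
    have h5 : A.clock (screenProj ξ (σ y)) v = Ω (σ y) * mvfderiv (𝓡 n) t y v :=
      (congrArg (A.clock (screenProj ξ (σ y)))
        (mfderiv_screenProj_mfderiv_section hq h1 h2 v).symm).trans ((hA.1 _ _).trans (h3 v))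
    have h6 : A.clock y v = Ω (σ y) * mvfderiv (𝓡 n) t y v := by
      rw [← h5, h4]
    rw [h6, ← hΩ', h4]
    rfl

/-- The structure of a screen worldvolume `σ`, given by lifting tangent vectors with the differential
of `σ`. The map `q ∘ σ` is bijective, and its differential is injective by transversality. -/
lemma IsScreenWorldvolume.exists_isInducedOnSubmanifold {W : Type*} [TopologicalSpace W]
    [ChartedSpace (EuclideanSpace ℝ (Fin n)) W] [IsManifold (𝓡 n) ∞ W] (hg : IsPlatonicWave g ξ)
    (hq : Manifold.IsSubmersion (𝓡 (n + 1)) (𝓡 n) ∞ (screenProj ξ))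
    {A : AristotelianStructure n (PlatonicScreen ξ)}
    (hA : A.IsInducedOnQuotient g ξ (screenProj ξ)) {σ : W → M}
    (hσ : IsScreenWorldvolume n ξ σ) :
    ∃ B : AristotelianStructure n W, B.IsInducedOnSubmanifold g ξ σ ∧
      ∃ Φ : Diffeomorph (𝓡 n) (𝓡 n) W (PlatonicScreen ξ) ∞,
        (∀ p, Φ p = screenProj ξ (σ p)) ∧ B.IsPullback A Φ := by
  have hσd : ContMDiff (𝓡 n) (𝓡 (n + 1)) ∞ σ := hσ.embedding.isImmersion.contMDiff
  have hinj (p : W) : Function.Injective (mfderiv (𝓡 n) (𝓡 (n + 1)) σ p) :=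
    (hσ.embedding.isImmersion.isImmersionOfComplement_complement p).mfderiv_injective
  have htrans (p : W) : IsTransverseAt ξ σ p := by
    intro v c hc
    by_cases h0 : c = 0
    · subst h0
      refine hinj p (hc.trans ?_)
      rw [zero_smul, map_zero]
    · refine (hσ.transverse p ⟨c⁻¹ • v, ?_⟩).elim
      refine (map_smul (mfderiv (𝓡 n) (𝓡 (n + 1)) σ p) _ _).trans ?_
      rw [hc, inv_smul_smul₀ h0]
  let B : AristotelianStructure n W := .ofLift hg σ (fun p => mfderiv (𝓡 n) (𝓡 (n + 1)) σ p)
    fun p => ⟨σ, htrans p, .of_forall fun s => ⟨hσd s, fun v => rfl, fun v w _ _ => rfl⟩⟩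
  have hqd : MDifferentiable (𝓡 (n + 1)) (𝓡 n) (screenProj ξ) :=
    hq.contMDiff.mdifferentiable (by simp)
  have hchain (p : W) (v : TangentSpace (𝓡 n) p) :
      mfderiv (𝓡 n) (𝓡 n) (fun p => screenProj ξ (σ p)) p v
        = mfderiv (𝓡 (n + 1)) (𝓡 n) (screenProj ξ) (σ p) (mfderiv (𝓡 n) (𝓡 (n + 1)) σ p v) :=
    DFunLike.congr_fun (mfderiv_comp p (hqd _) (hσd.mdifferentiableAt (by simp))) v
  have hsurj {f : EuclideanSpace ℝ (Fin n) →L[ℝ] EuclideanSpace ℝ (Fin n)}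
      (hf : Function.Injective f) : Function.Surjective f :=
    LinearMap.injective_iff_surjective (f := f.toLinearMap).1 hf
  obtain ⟨Φ, hΦ⟩ := exists_diffeomorph_of_bijective (hq.contMDiff.comp hσd) hσ.representatives
    fun p => by
      have h1 : Function.Injective (mfderiv (𝓡 n) (𝓡 n) (fun p => screenProj ξ (σ p)) p) := by
        refine (injective_iff_map_eq_zero _).2 fun v hv => ?_
        obtain ⟨c, hc⟩ := exists_eq_smul_of_mfderiv_screenProj_eq_zero hg hq
          ((hchain p v).symm.trans hv)
        exact htrans p v c hc
      exact ⟨h1, hsurj h1⟩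
  have hΦ' : (Φ : W → PlatonicScreen ξ) = fun p => screenProj ξ (σ p) := funext hΦ
  refine ⟨B, ⟨fun p v => rfl, fun p v w => rfl⟩, Φ, hΦ, ?_⟩
  rw [hΦ']
  refine ⟨fun p v => ?_, fun p v w v' w' hv hw => ?_⟩
  · rw [hchain]
    exact (hA.1 _ _).symm
  · exact (hA.2 _ _ _ v' w' ((hchain p v).symm.trans hv) ((hchain p w).symm.trans hw)).symm

end Screen

theorem proposition4p17 {n : ℕ} {M : Type*} [TopologicalSpace M] [T2Space M] [ConnectedSpace M]
    [ChartedSpace (EuclideanSpace ℝ (Fin (n + 1))) M] [IsManifold (𝓡 (n + 1)) ∞ M]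
    (g : LorentzianMetric (n + 1) M) (ξ : (x : M) → TangentSpace (𝓡 (n + 1)) x)
    (hg : IsPlatonicWave g ξ)
    -- The orbit space of the rays is an `n`-dimensional quotient manifold of `M`.
    [T2Space (PlatonicScreen ξ)] [ChartedSpace (EuclideanSpace ℝ (Fin n)) (PlatonicScreen ξ)]
    [IsManifold (𝓡 n) ∞ (PlatonicScreen ξ)]
    (hq : Manifold.IsSubmersion (𝓡 (n + 1)) (𝓡 n) ∞ (screenProj ξ)) :
    ConnectedSpace (PlatonicScreen ξ) ∧
    ∃ A : AristotelianStructure n (PlatonicScreen ξ),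
      -- `A` is the one and only Aristotelian structure induced from the ambient metric.
      A.IsInducedOnQuotient g ξ (screenProj ξ) ∧
      (∀ A' : AristotelianStructure n (PlatonicScreen ξ),
        A'.IsInducedOnQuotient g ξ (screenProj ξ) → A' = A) ∧
      -- Every conformal factor `Ω` descends to the screen, and locally `ψ = Ω dt` there.
      (∀ Ω : M → ℝ, IsConformalFactor g ξ Ω →
        ∃ Ω' : PlatonicScreen ξ → ℝ, ContMDiff (𝓡 n) 𝓘(ℝ, ℝ) ∞ Ω' ∧ (∀ s, 0 < Ω' s) ∧
          (∀ x, Ω' (screenProj ξ x) = Ω x) ∧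
          ∀ s, ∃ (U : Set (PlatonicScreen ξ)) (t : PlatonicScreen ξ → ℝ), IsOpen U ∧ s ∈ U ∧
            ContMDiffOn (𝓡 n) 𝓘(ℝ, ℝ) ∞ t U ∧
            ∀ y ∈ U, A.clock y = Ω' y • mvfderiv (𝓡 n) t y) ∧
      -- On every screen worldvolume the ambient metric induces the same structure.
      ∀ (W : Type*) [TopologicalSpace W] [ChartedSpace (EuclideanSpace ℝ (Fin n)) W]
        [IsManifold (𝓡 n) ∞ W] (σ : W → M), IsScreenWorldvolume n ξ σ →
          ∃ B : AristotelianStructure n W, B.IsInducedOnSubmanifold g ξ σ ∧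
            ∃ Φ : Diffeomorph (𝓡 n) (𝓡 n) W (PlatonicScreen ξ) ∞,
              (∀ p, Φ p = screenProj ξ (σ p)) ∧ B.IsPullback A Φ := by
  have : ConnectedSpace (PlatonicScreen ξ) := inferInstanceAs (ConnectedSpace (Quotient _))
  obtain ⟨A, hA⟩ := exists_isInducedOnQuotient hg hq
  exact ⟨this, A, hA, fun A' hA' => AristotelianStructure.eq_of_isInducedOnQuotient hq hA hA',
    fun Ω hΩ => hΩ.exists_screen hg hq hA,
    fun W _ _ _ σ hσ => hσ.exists_isInducedOnSubmanifold hg hq hA⟩
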